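/- **Theorem.** There is a non-trivial model of dependent type theory with Agda-style cumulativity in which every function $f : \mathcal U_\ell \to A$ with $A : \mathcal U_\ell$ is constant. Here a *model of dependent type theory* is a category with families (contexts, substitutions, types, terms, context extension, empty context) in which every type has a level $\ell \in \mathbb N$, equipped with the following structure, all strictly stable under substitution: * dependent function types $\Pi$ and dependent pair types $\Sigma$, with $\beta$ and $\eta$, where $\Pi_{x:A}B$ and $\Sigma_{x:A}B$ have level $\max(m,n)$ if $A$ has level $m$ and $B$ has level $n$; * a unit type (with $\eta$), an empty type, a type $\mathsf{Bool}$ of booleans and a type of natural numbers, all of level $0$, the last three with dependent elimination into types of every level and, for booleans and natural numbers, with the computation rules; * intensional identity types, of the same level as the underlying type, with path induction into types of every level and its computation rule; * for every $\ell \in \mathbb N$ a universe $\mathcal U_\ell$, itself a type of level $\ell+1$, whose terms in a context $\Gamma$ correspond bijectively to the types of level $\ell$ in $\Gamma$. *Agda-style cumulativity* means that for all $\ell$ and $X : \mathcal U_\ell$ (in any context) there is $\mathsf{Lift}\,X : \mathcal U_{\ell+1}$ together with an isomorphism $\mathsf{Lift}\,X \cong X$, i.e. a bijection between the terms of $\mathsf{Lift}\,X$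 and those of $X$, all stable under substitution. The model is *non-trivial* in the sense that the empty type has no term in the empty context and the terms $\mathsf{true}$ and $\mathsf{false}$ of $\mathsf{Bool}$ in the empty context are different. *Every function is constant* means: for every context $\Gamma$, every $\ell \in \mathbb N$, every term $A$ of $\mathcal U_\ell$ in $\Gamma$ and every term $f$ of $\mathcal U_\ell \to A$ in $\Gamma$, there is a term $a$ of $A$ in $\Gamma$ such that $f = \lambda X.\,a$ holds in the model. -/

import Mathlib

open CategoryTheory

namespace DTT

universe u v

/-- A category with families in which every type carries a universe level `ℓ : ℕ`.
`Ty Γ ℓ` are the types of level `ℓ` in context `Γ`, `Tm A` are the terms of type `A`,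
`ext A` is the extended context `Γ.A`, with weakening `p A : Γ.A ⟶ Γ` and last variable `q A`.
Equality of types and of terms is judgemental equality. Where the types of two terms are equal
by an earlier law but not syntactically, the equality of the terms is written with `HEq`. -/
structure LeveledCwF where
  /-- contexts -/
  Ctx : Type u
  /-- substitutions `Γ ⟶ Δ` -/
  [cat : Category.{v} Ctx]
  /-- the empty context -/
  emp : Ctx
  empTerminal : Limits.IsTerminal emp
  Ty : Ctx → ℕ → Type v
  Tm : {Γ : Ctx} → {ℓ : ℕ} → Ty Γ ℓ → Type v
  /-- the substitution `A[σ]` in types -/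
  tySub : {Γ Δ : Ctx} → {ℓ : ℕ} → Ty Δ ℓ → (Γ ⟶ Δ) → Ty Γ ℓ
  tySub_id : ∀ {Γ : Ctx} {ℓ : ℕ} (A : Ty Γ ℓ), tySub A (𝟙 Γ) = A
  tySub_comp : ∀ {Γ Δ Θ : Ctx} {ℓ : ℕ} (A : Ty Θ ℓ) (σ : Γ ⟶ Δ) (τ : Δ ⟶ Θ),
    tySub A (σ ≫ τ) = tySub (tySub A τ) σ
  /-- the substitution `t[σ]` in terms -/
  tmSub : {Γ Δ : Ctx} → {ℓ : ℕ} → {A : Ty Δ ℓ} → Tm A → (σ : Γ ⟶ Δ) → Tm (tySub A σ)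
  tmSub_id : ∀ {Γ : Ctx} {ℓ : ℕ} {A : Ty Γ ℓ} (t : Tm A), HEq (tmSub t (𝟙 Γ)) t
  tmSub_comp : ∀ {Γ Δ Θ : Ctx} {ℓ : ℕ} {A : Ty Θ ℓ} (t : Tm A) (σ : Γ ⟶ Δ) (τ : Δ ⟶ Θ),
    HEq (tmSub t (σ ≫ τ)) (tmSub (tmSub t τ) σ)
  ext : {Γ : Ctx} → {ℓ : ℕ} → Ty Γ ℓ → Ctx
  p : {Γ : Ctx} → {ℓ : ℕ} → (A : Ty Γ ℓ) → (ext A ⟶ Γ)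
  q : {Γ : Ctx} → {ℓ : ℕ} → (A : Ty Γ ℓ) → Tm (tySub A (p A))
  /-- the extended substitution `⟨σ, t⟩` -/
  pair : {Γ Δ : Ctx} → {ℓ : ℕ} → {A : Ty Δ ℓ} → (σ : Γ ⟶ Δ) → Tm (tySub A σ) → (Γ ⟶ ext A)
  pair_p : ∀ {Γ Δ : Ctx} {ℓ : ℕ} {A : Ty Δ ℓ} (σ : Γ ⟶ Δ) (t : Tm (tySub A σ)),
    pair σ t ≫ p A = σ
  pair_q : ∀ {Γ Δ : Ctx} {ℓ : ℕ} {A : Ty Δ ℓ} (σ : Γ ⟶ Δ) (t : Tm (tySub A σ)),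
    HEq (tmSub (q A) (pair σ t)) t
  pair_unique : ∀ {Γ Δ : Ctx} {ℓ : ℕ} {A : Ty Δ ℓ} (τ τ' : Γ ⟶ ext A),
    τ ≫ p A = τ' ≫ p A → HEq (tmSub (q A) τ) (tmSub (q A) τ') → τ = τ'

attribute [instance] LeveledCwF.cat

namespace LeveledCwF

variable {M : LeveledCwF.{u, v}} {Γ Δ Θ : M.Ctx} {ℓ m n : ℕ}

/-- A term of type `A` seen as a term of the equal type `B`. -/
def conv {A B : M.Ty Γ ℓ} (h : A = B) (t : M.Tm A) : M.Tm B := h ▸ t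

theorem conv_heq {A B : M.Ty Γ ℓ} (h : A = B) (t : M.Tm A) : HEq (conv h t) t := by
  subst h; rfl

theorem tmSub_heq {A B : M.Ty Δ ℓ} (h : A = B) {s : M.Tm A} {t : M.Tm B} (hst : HEq s t)
    {σ τ : Γ ⟶ Δ} (hσ : σ = τ) : HEq (M.tmSub s σ) (M.tmSub t τ) := by
  subst h; subst hσ; cases hst; rfl

/-- The substitution `Γ.A[σ] ⟶ Δ.A` that acts as `σ` below the last variable. The type `A'`
is any type equal to `A[σ]`. -/
def lift (σ : Γ ⟶ Δ) {A : M.Ty Δ ℓ} {A' : M.Ty Γ ℓ} (h : A' = M.tySub A σ) :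
    M.ext A' ⟶ M.ext A :=
  M.pair (M.p A' ≫ σ) (conv (by rw [h, M.tySub_comp]) (M.q A'))

/-- The substitution `⟨id, a⟩ : Γ ⟶ Γ.A`. -/
def inst {A : M.Ty Γ ℓ} (a : M.Tm A) : Γ ⟶ M.ext A :=
  M.pair (𝟙 Γ) (conv (M.tySub_id A).symm a)

theorem inst_p {A : M.Ty Γ ℓ} (a : M.Tm A) : inst a ≫ M.p A = 𝟙 Γ := M.pair_p _ _

theorem inst_q {A : M.Ty Γ ℓ} (a : M.Tm A) : HEq (M.tmSub (M.q A) (inst a)) a :=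
  (M.pair_q _ _).trans (conv_heq _ _)

theorem lift_p (σ : Γ ⟶ Δ) {A : M.Ty Δ ℓ} {A' : M.Ty Γ ℓ} (h : A' = M.tySub A σ) :
    lift σ h ≫ M.p A = M.p A' ≫ σ := M.pair_p _ _

theorem lift_q (σ : Γ ⟶ Δ) {A : M.Ty Δ ℓ} {A' : M.Ty Γ ℓ} (h : A' = M.tySub A σ) :
    HEq (M.tmSub (M.q A) (lift σ h)) (M.q A') := (M.pair_q _ _).trans (conv_heq _ _)

/-- `⟨τ, t⟩` after `σ` has last component `t[σ]`. -/
theorem comp_pair_q (σ : Γ ⟶ Δ) (τ : Δ ⟶ Θ) {A : M.Ty Θ ℓ} (t : M.Tm (M.tySub A τ)) :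
    HEq (M.tmSub (M.q A) (σ ≫ M.pair τ t)) (M.tmSub t σ) :=
  (M.tmSub_comp _ _ _).trans
    (tmSub_heq (by rw [← M.tySub_comp, M.pair_p]) (M.pair_q _ _) rfl)

theorem sub_inst (σ : Γ ⟶ Δ) {A : M.Ty Δ ℓ} {A' : M.Ty Γ ℓ} (h : A' = M.tySub A σ)
    (a : M.Tm A) (a' : M.Tm A') (ha : HEq a' (M.tmSub a σ)) :
    σ ≫ inst a = inst a' ≫ lift σ h := by
  apply M.pair_unique
  · rw [Category.assoc, Category.assoc, inst_p, lift_p, ← Category.assoc, inst_p,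
      Category.comp_id, Category.id_comp]
  · refine (comp_pair_q _ _ _).trans ?_
    refine (tmSub_heq (M.tySub_id A) (conv_heq _ _) rfl).trans ?_
    refine HEq.trans ?_ (comp_pair_q _ _ _).symm
    refine ha.symm.trans ?_
    refine (inst_q a').symm.trans ?_
    exact tmSub_heq (by rw [h, M.tySub_comp]) (conv_heq _ _).symm rfl

/-- `C[a][σ] = C[σ][a[σ]]`, the types of the methods of the eliminators below. -/
theorem tySub_inst (σ : Γ ⟶ Δ) {A : M.Ty Δ ℓ} {A' : M.Ty Γ ℓ} (h : A' = M.tySub A σ)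
    (a : M.Tm A) (a' : M.Tm A') (ha : HEq a' (M.tmSub a σ)) (C : M.Ty (M.ext A) n) :
    M.tySub (M.tySub C (inst a)) σ = M.tySub (M.tySub C (lift σ h)) (inst a') := by
  rw [← M.tySub_comp, ← M.tySub_comp, sub_inst σ h a a' ha]

end LeveledCwF

open LeveledCwF

variable (M : LeveledCwF.{u, v})

/-- Dependent function types: `lam` is bijective (β and η) and stable under substitution. -/
structure PiTypes where
  Pi : {Γ : M.Ctx} → {m n : ℕ} → (A : M.Ty Γ m) → M.Ty (M.ext A) n → M.Ty Γ (max m n)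
  Pi_sub : ∀ {Γ Δ : M.Ctx} {m n : ℕ} (σ : Γ ⟶ Δ) (A : M.Ty Δ m) (B : M.Ty (M.ext A) n),
    M.tySub (Pi A B) σ = Pi (M.tySub A σ) (M.tySub B (lift σ rfl))
  lam : {Γ : M.Ctx} → {m n : ℕ} → {A : M.Ty Γ m} → {B : M.Ty (M.ext A) n} →
    M.Tm B ≃ M.Tm (Pi A B)
  lam_sub : ∀ {Γ Δ : M.Ctx} {m n : ℕ} (σ : Γ ⟶ Δ) {A : M.Ty Δ m} {B : M.Ty (M.ext A) n}
    (b : M.Tm B), HEq (M.tmSub (lam b) σ) (lam (M.tmSub b (lift σ rfl)))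

/-- Dependent pair types: pairing is bijective (β and η) and stable under substitution. -/
structure SigmaTypes where
  Sig : {Γ : M.Ctx} → {m n : ℕ} → (A : M.Ty Γ m) → M.Ty (M.ext A) n → M.Ty Γ (max m n)
  Sig_sub : ∀ {Γ Δ : M.Ctx} {m n : ℕ} (σ : Γ ⟶ Δ) (A : M.Ty Δ m) (B : M.Ty (M.ext A) n),
    M.tySub (Sig A B) σ = Sig (M.tySub A σ) (M.tySub B (lift σ rfl))
  dpair : {Γ : M.Ctx} → {m n : ℕ} → {A : M.Ty Γ m} → {B : M.Ty (M.ext A) n} →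
    ((a : M.Tm A) × M.Tm (M.tySub B (inst a))) ≃ M.Tm (Sig A B)
  dpair_sub : ∀ {Γ Δ : M.Ctx} {m n : ℕ} (σ : Γ ⟶ Δ) {A : M.Ty Δ m} {B : M.Ty (M.ext A) n}
    (a : M.Tm A) (b : M.Tm (M.tySub B (inst a))),
    HEq (M.tmSub (dpair ⟨a, b⟩) σ)
      (dpair (A := M.tySub A σ) (B := M.tySub B (lift σ rfl))
        ⟨M.tmSub a σ, conv (tySub_inst σ rfl a _ HEq.rfl B) (M.tmSub b σ)⟩)

/-- The unit type, with η. -/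
structure UnitType where
  unitTy : (Γ : M.Ctx) → M.Ty Γ 0
  unitTy_sub : ∀ {Γ Δ : M.Ctx} (σ : Γ ⟶ Δ), M.tySub (unitTy Δ) σ = unitTy Γ
  star : (Γ : M.Ctx) → M.Tm (unitTy Γ)
  star_unique : ∀ {Γ : M.Ctx} (t : M.Tm (unitTy Γ)), t = star Γ

/-- The empty type, with elimination into types of all levels. -/
structure EmptyType where
  emptyTy : (Γ : M.Ctx) → M.Ty Γ 0
  emptyTy_sub : ∀ {Γ Δ : M.Ctx} (σ : Γ ⟶ Δ), M.tySub (emptyTy Δ) σ = emptyTy Γ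
  emptyElim : {Γ : M.Ctx} → {n : ℕ} → (C : M.Ty (M.ext (emptyTy Γ)) n) → M.Tm C
  emptyElim_sub : ∀ {Γ Δ : M.Ctx} {n : ℕ} (σ : Γ ⟶ Δ) (C : M.Ty (M.ext (emptyTy Δ)) n),
    M.tmSub (emptyElim C) (lift σ (emptyTy_sub σ).symm) =
      emptyElim (M.tySub C (lift σ (emptyTy_sub σ).symm))

/-- The type of booleans, with elimination into types of all levels. -/
structure BoolType where
  boolTy : (Γ : M.Ctx) → M.Ty Γ 0
  boolTy_sub : ∀ {Γ Δ : M.Ctx} (σ : Γ ⟶ Δ), M.tySub (boolTy Δ) σ = boolTy Γ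
  tt : (Γ : M.Ctx) → M.Tm (boolTy Γ)
  ff : (Γ : M.Ctx) → M.Tm (boolTy Γ)
  tt_sub : ∀ {Γ Δ : M.Ctx} (σ : Γ ⟶ Δ), HEq (M.tmSub (tt Δ) σ) (tt Γ)
  ff_sub : ∀ {Γ Δ : M.Ctx} (σ : Γ ⟶ Δ), HEq (M.tmSub (ff Δ) σ) (ff Γ)
  boolElim : {Γ : M.Ctx} → {n : ℕ} → (C : M.Ty (M.ext (boolTy Γ)) n) →
    M.Tm (M.tySub C (inst (tt Γ))) → M.Tm (M.tySub C (inst (ff Γ))) → M.Tm C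
  boolElim_tt : ∀ {Γ : M.Ctx} {n : ℕ} (C : M.Ty (M.ext (boolTy Γ)) n)
    (t : M.Tm (M.tySub C (inst (tt Γ)))) (f : M.Tm (M.tySub C (inst (ff Γ)))),
    M.tmSub (boolElim C t f) (inst (tt Γ)) = t
  boolElim_ff : ∀ {Γ : M.Ctx} {n : ℕ} (C : M.Ty (M.ext (boolTy Γ)) n)
    (t : M.Tm (M.tySub C (inst (tt Γ)))) (f : M.Tm (M.tySub C (inst (ff Γ)))),
    M.tmSub (boolElim C t f) (inst (ff Γ)) = f
  boolElim_sub : ∀ {Γ Δ : M.Ctx} {n : ℕ} (σ : Γ ⟶ Δ) (C : M.Ty (M.ext (boolTy Δ)) n)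
    (t : M.Tm (M.tySub C (inst (tt Δ)))) (f : M.Tm (M.tySub C (inst (ff Δ)))),
    M.tmSub (boolElim C t f) (lift σ (boolTy_sub σ).symm) =
      boolElim (M.tySub C (lift σ (boolTy_sub σ).symm))
        (conv (tySub_inst σ _ _ _ (tt_sub σ).symm C) (M.tmSub t σ))
        (conv (tySub_inst σ _ _ _ (ff_sub σ).symm C) (M.tmSub f σ))

/-- Formation and introduction rules of the type of natural numbers. -/
structure NatIntro where
  natTy : (Γ : M.Ctx) → M.Ty Γ 0
  natTy_sub : ∀ {Γ Δ : M.Ctx} (σ : Γ ⟶ Δ), M.tySub (natTy Δ) σ = natTy Γ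
  zero : (Γ : M.Ctx) → M.Tm (natTy Γ)
  zero_sub : ∀ {Γ Δ : M.Ctx} (σ : Γ ⟶ Δ), HEq (M.tmSub (zero Δ) σ) (zero Γ)
  succ : {Γ : M.Ctx} → M.Tm (natTy Γ) → M.Tm (natTy Γ)
  succ_sub : ∀ {Γ Δ : M.Ctx} (σ : Γ ⟶ Δ) (t : M.Tm (natTy Δ)),
    conv (natTy_sub σ) (M.tmSub (succ t) σ) = succ (conv (natTy_sub σ) (M.tmSub t σ))

variable {M}

namespace NatIntro

variable (N : NatIntro M) {Γ Δ : M.Ctx} {n : ℕ}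

/-- The substitution `Γ.ℕ ⟶ Γ.ℕ` that sends the last variable `x` to `succ x`. -/
def succSub (Γ : M.Ctx) : M.ext (N.natTy Γ) ⟶ M.ext (N.natTy Γ) :=
  M.pair (M.p (N.natTy Γ))
    (conv (N.natTy_sub _).symm (N.succ (conv (N.natTy_sub _) (M.q (N.natTy Γ)))))

theorem lift_succSub (σ : Γ ⟶ Δ) :
    lift σ (N.natTy_sub σ).symm ≫ N.succSub Δ =
      N.succSub Γ ≫ lift σ (N.natTy_sub σ).symm := by
  apply M.pair_unique
  · simp only [Category.assoc, lift_p, succSub, M.pair_p]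
    rw [← Category.assoc, M.pair_p]
  · refine (comp_pair_q _ _ _).trans ?_
    refine HEq.trans ?_ (comp_pair_q _ _ _).symm
    refine (tmSub_heq (N.natTy_sub _) (conv_heq _ _) rfl).trans ?_
    refine (conv_heq (N.natTy_sub _) _).symm.trans ?_
    rw [N.succ_sub]
    have e : conv (N.natTy_sub (lift σ (N.natTy_sub σ).symm))
        (M.tmSub (conv (N.natTy_sub _) (M.q (N.natTy Δ))) (lift σ (N.natTy_sub σ).symm)) =
        conv (N.natTy_sub _) (M.q (N.natTy Γ)) := by
      apply eq_of_heq
      refine (conv_heq _ _).trans ?_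
      refine (tmSub_heq (N.natTy_sub _).symm (conv_heq _ _) rfl).trans ?_
      exact (lift_q σ (N.natTy_sub σ).symm).trans (conv_heq _ _).symm
    rw [e]
    refine (conv_heq (N.natTy_sub (M.p _)).symm _).symm.trans ?_
    refine (M.pair_q (A := N.natTy Γ) _ _).symm.trans ?_
    exact tmSub_heq (by rw [M.tySub_comp, N.natTy_sub, N.natTy_sub, N.natTy_sub])
      (conv_heq _ _).symm rfl

theorem tySub_succSub (σ : Γ ⟶ Δ) (C : M.Ty (M.ext (N.natTy Δ)) n) :
    M.tySub (M.tySub C (M.p C ≫ N.succSub Δ)) (lift (lift σ (N.natTy_sub σ).symm) rfl) =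
      M.tySub (M.tySub C (lift σ (N.natTy_sub σ).symm))
        (M.p (M.tySub C (lift σ (N.natTy_sub σ).symm)) ≫ N.succSub Γ) := by
  rw [← M.tySub_comp, ← M.tySub_comp, ← Category.assoc, lift_p, Category.assoc, Category.assoc,
    lift_succSub]

end NatIntro

variable (M)

/-- The type of natural numbers, with elimination into types of all levels.
The method for the successor lives in the context `Γ, x : ℕ, y : C x` and has type
`C (succ x)`. -/
structure NatType extends NatIntro M where
  natElim : {Γ : M.Ctx} → {n : ℕ} → (C : M.Ty (M.ext (natTy Γ)) n) →
    M.Tm (M.tySub C (inst (zero Γ))) →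
    M.Tm (M.tySub C (M.p C ≫ toNatIntro.succSub Γ)) → M.Tm C
  natElim_zero : ∀ {Γ : M.Ctx} {n : ℕ} (C : M.Ty (M.ext (natTy Γ)) n)
    (z : M.Tm (M.tySub C (inst (zero Γ))))
    (s : M.Tm (M.tySub C (M.p C ≫ toNatIntro.succSub Γ))),
    M.tmSub (natElim C z s) (inst (zero Γ)) = z
  natElim_succ : ∀ {Γ : M.Ctx} {n : ℕ} (C : M.Ty (M.ext (natTy Γ)) n)
    (z : M.Tm (M.tySub C (inst (zero Γ))))
    (s : M.Tm (M.tySub C (M.p C ≫ toNatIntro.succSub Γ))),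
    HEq (M.tmSub (natElim C z s) (toNatIntro.succSub Γ))
      (M.tmSub s (inst (natElim C z s)))
  natElim_sub : ∀ {Γ Δ : M.Ctx} {n : ℕ} (σ : Γ ⟶ Δ) (C : M.Ty (M.ext (natTy Δ)) n)
    (z : M.Tm (M.tySub C (inst (zero Δ))))
    (s : M.Tm (M.tySub C (M.p C ≫ toNatIntro.succSub Δ))),
    M.tmSub (natElim C z s) (lift σ (natTy_sub σ).symm) =
      natElim (M.tySub C (lift σ (natTy_sub σ).symm))
        (conv (tySub_inst σ _ _ _ (zero_sub σ).symm C) (M.tmSub z σ))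
        (conv (toNatIntro.tySub_succSub σ C)
          (M.tmSub s (lift (lift σ (natTy_sub σ).symm) rfl)))

/-- Formation and introduction rules of (intensional) identity types. -/
structure IdIntro where
  Id : {Γ : M.Ctx} → {ℓ : ℕ} → {A : M.Ty Γ ℓ} → M.Tm A → M.Tm A → M.Ty Γ ℓ
  Id_sub : ∀ {Γ Δ : M.Ctx} {ℓ : ℕ} (σ : Γ ⟶ Δ) {A : M.Ty Δ ℓ} (a b : M.Tm A),
    M.tySub (Id a b) σ = Id (M.tmSub a σ) (M.tmSub b σ)
  refl : {Γ : M.Ctx} → {ℓ : ℕ} → {A : M.Ty Γ ℓ} → (a : M.Tm A) → M.Tm (Id a a)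
  refl_sub : ∀ {Γ Δ : M.Ctx} {ℓ : ℕ} (σ : Γ ⟶ Δ) {A : M.Ty Δ ℓ} (a : M.Tm A),
    HEq (M.tmSub (refl a) σ) (refl (M.tmSub a σ))

variable {M}

namespace IdIntro

variable (I : IdIntro M) {Γ Δ : M.Ctx} {ℓ n : ℕ}

theorem Id_congr {A B : M.Ty Γ ℓ} (h : A = B) {a b : M.Tm A} {c d : M.Tm B}
    (hac : HEq a c) (hbd : HEq b d) : I.Id a b = I.Id c d := by
  subst h; cases hac; cases hbd; rfl

theorem refl_congr {A B : M.Ty Γ ℓ} (h : A = B) {a : M.Tm A} {c : M.Tm B}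
    (hac : HEq a c) : HEq (I.refl a) (I.refl c) := by
  subst h; cases hac; rfl

/-- The type of identifications of `a` with the last variable `x`, in the context
`Γ, x : A`. -/
def fromTy {A : M.Ty Γ ℓ} (a : M.Tm A) : M.Ty (M.ext A) ℓ :=
  I.Id (M.tmSub a (M.p A)) (M.q A)

theorem fromTy_sub (σ : Γ ⟶ Δ) {A : M.Ty Δ ℓ} (a : M.Tm A) :
    I.fromTy (M.tmSub a σ) = M.tySub (I.fromTy a) (lift σ rfl) := by
  refine Eq.trans ?_ (I.Id_sub _ _ _).symm
  refine I.Id_congr ?_ ?_ (lift_q σ rfl).symm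
  · rw [← M.tySub_comp, ← M.tySub_comp, lift_p]
  · refine (M.tmSub_comp _ _ _).symm.trans (HEq.trans ?_ (M.tmSub_comp _ _ _))
    exact tmSub_heq rfl HEq.rfl (lift_p σ rfl).symm

theorem fromTy_inst {A : M.Ty Γ ℓ} (a : M.Tm A) :
    I.Id a a = M.tySub (I.fromTy a) (inst a) := by
  refine Eq.trans ?_ (I.Id_sub _ _ _).symm
  refine I.Id_congr ?_ ?_ (inst_q a).symm
  · rw [← M.tySub_comp, inst_p, M.tySub_id]
  · refine (M.tmSub_id a).symm.trans (HEq.trans ?_ (M.tmSub_comp _ _ _))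
    exact tmSub_heq rfl HEq.rfl (inst_p a).symm

/-- The substitution `⟨id, a, refl a⟩ : Γ ⟶ (Γ, x : A, e : Id a x)`. -/
def reflSub {A : M.Ty Γ ℓ} (a : M.Tm A) : Γ ⟶ M.ext (I.fromTy a) :=
  M.pair (inst a) (conv (I.fromTy_inst a) (I.refl a))

theorem sub_reflSub (σ : Γ ⟶ Δ) {A : M.Ty Δ ℓ} (a : M.Tm A) :
    σ ≫ I.reflSub a =
      I.reflSub (M.tmSub a σ) ≫ lift (lift σ rfl) (I.fromTy_sub σ a) := by
  have hi := sub_inst σ rfl a (M.tmSub a σ) HEq.rfl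
  apply M.pair_unique
  · simp only [Category.assoc, lift_p, reflSub, M.pair_p]
    rw [← Category.assoc, M.pair_p, hi]
  · refine (comp_pair_q _ _ _).trans ?_
    refine HEq.trans ?_ (comp_pair_q _ _ _).symm
    refine (tmSub_heq (I.fromTy_inst a).symm (conv_heq _ _) rfl).trans ?_
    refine (I.refl_sub σ a).trans ?_
    refine (conv_heq (I.fromTy_inst (M.tmSub a σ)) _).symm.trans ?_
    refine (M.pair_q (A := I.fromTy (M.tmSub a σ)) _ _).symm.trans ?_
    exact tmSub_heq (by rw [I.fromTy_sub, M.tySub_comp]) (conv_heq _ _).symm rfl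

theorem tySub_reflSub (σ : Γ ⟶ Δ) {A : M.Ty Δ ℓ} (a : M.Tm A)
    (C : M.Ty (M.ext (I.fromTy a)) n) :
    M.tySub (M.tySub C (I.reflSub a)) σ =
      M.tySub (M.tySub C (lift (lift σ rfl) (I.fromTy_sub σ a)))
        (I.reflSub (M.tmSub a σ)) := by
  rw [← M.tySub_comp, ← M.tySub_comp, sub_reflSub]

end IdIntro

variable (M)

/-- Intensional identity types: based path induction into types of all levels. -/
structure IdTypes extends IdIntro M where
  J : {Γ : M.Ctx} → {ℓ n : ℕ} → {A : M.Ty Γ ℓ} → (a : M.Tm A) →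
    (C : M.Ty (M.ext (toIdIntro.fromTy a)) n) →
    M.Tm (M.tySub C (toIdIntro.reflSub a)) → M.Tm C
  J_refl : ∀ {Γ : M.Ctx} {ℓ n : ℕ} {A : M.Ty Γ ℓ} (a : M.Tm A)
    (C : M.Ty (M.ext (toIdIntro.fromTy a)) n) (d : M.Tm (M.tySub C (toIdIntro.reflSub a))),
    M.tmSub (J a C d) (toIdIntro.reflSub a) = d
  J_sub : ∀ {Γ Δ : M.Ctx} {ℓ n : ℕ} (σ : Γ ⟶ Δ) {A : M.Ty Δ ℓ} (a : M.Tm A)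
    (C : M.Ty (M.ext (toIdIntro.fromTy a)) n) (d : M.Tm (M.tySub C (toIdIntro.reflSub a))),
    M.tmSub (J a C d) (lift (lift σ rfl) (toIdIntro.fromTy_sub σ a)) =
      J (M.tmSub a σ) (M.tySub C (lift (lift σ rfl) (toIdIntro.fromTy_sub σ a)))
        (conv (toIdIntro.tySub_reflSub σ a C) (M.tmSub d σ))

/-- The hierarchy of universes `U ℓ`, of level `ℓ + 1`. The terms of `U ℓ` are, up to the
bijection `El`, exactly the types of level `ℓ`; so each universe is closed under all the type
formers. -/
structure Universes where
  U : (Γ : M.Ctx) → (ℓ : ℕ) → M.Ty Γ (ℓ + 1)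
  U_sub : ∀ {Γ Δ : M.Ctx} (σ : Γ ⟶ Δ) (ℓ : ℕ), M.tySub (U Δ ℓ) σ = U Γ ℓ
  El : {Γ : M.Ctx} → {ℓ : ℕ} → M.Tm (U Γ ℓ) ≃ M.Ty Γ ℓ
  El_sub : ∀ {Γ Δ : M.Ctx} {ℓ : ℕ} (σ : Γ ⟶ Δ) (X : M.Tm (U Δ ℓ)),
    M.tySub (El X) σ = El (conv (U_sub σ ℓ) (M.tmSub X σ))

/-- Agda-style cumulativity: for `X : U ℓ` there is `Lift X : U (ℓ + 1)` with `Lift X ≅ X`,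
all stably under substitution. -/
structure AgdaLift (univ : Universes M) where
  Lift : {Γ : M.Ctx} → {ℓ : ℕ} → M.Tm (univ.U Γ ℓ) → M.Tm (univ.U Γ (ℓ + 1))
  Lift_sub : ∀ {Γ Δ : M.Ctx} {ℓ : ℕ} (σ : Γ ⟶ Δ) (X : M.Tm (univ.U Δ ℓ)),
    conv (univ.U_sub σ (ℓ + 1)) (M.tmSub (Lift X) σ) =
      Lift (conv (univ.U_sub σ ℓ) (M.tmSub X σ))
  iso : {Γ : M.Ctx} → {ℓ : ℕ} → (X : M.Tm (univ.U Γ ℓ)) →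
    M.Tm (univ.El (Lift X)) ≃ M.Tm (univ.El X)
  iso_sub : ∀ {Γ Δ : M.Ctx} {ℓ : ℕ} (σ : Γ ⟶ Δ) (X : M.Tm (univ.U Δ ℓ))
    (t : M.Tm (univ.El (Lift X))),
    conv (univ.El_sub σ X) (M.tmSub (iso X t) σ) =
      iso (conv (univ.U_sub σ ℓ) (M.tmSub X σ))
        (conv ((univ.El_sub σ (Lift X)).trans (congrArg univ.El (Lift_sub σ X)))
          (M.tmSub t σ))

/-- A model of dependent type theory with `Π`, `Σ`, unit, empty, boolean, natural number and
identity types, a hierarchy of universes `U 0 : U 1 : U 2 : ⋯`, and Agda-style cumulativity. -/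
structure Model extends LeveledCwF.{u, v} where
  pi : PiTypes toLeveledCwF
  sigma : SigmaTypes toLeveledCwF
  unit : UnitType toLeveledCwF
  empty : EmptyType toLeveledCwF
  bool : BoolType toLeveledCwF
  nat : NatType toLeveledCwF
  ident : IdTypes toLeveledCwF
  univ : Universes toLeveledCwF
  cumul : AgdaLift toLeveledCwF univ

namespace Model

/-- The model is logically consistent, and it distinguishes the two booleans. -/
def Nontrivial (𝓜 : Model.{u, v}) : Prop :=
  IsEmpty (𝓜.Tm (𝓜.empty.emptyTy 𝓜.emp)) ∧ 𝓜.bool.tt 𝓜.emp ≠ 𝓜.bool.ff 𝓜.emp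

variable {𝓜 : Model.{u, v}} {Γ : 𝓜.Ctx} {m n : ℕ}

/-- The type `A → B` of non-dependent functions. -/
def arrow (A : 𝓜.Ty Γ m) (B : 𝓜.Ty Γ n) : 𝓜.Ty Γ (max m n) :=
  𝓜.pi.Pi A (𝓜.tySub B (𝓜.p A))

/-- The function `f : A → B` is of the form `λ _. b`. -/
def IsConstant {A : 𝓜.Ty Γ m} {B : 𝓜.Ty Γ n} (f : 𝓜.Tm (arrow A B)) : Prop :=
  ∃ b : 𝓜.Tm B, f = 𝓜.pi.lam (𝓜.tmSub b (𝓜.p A))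

end Model

end DTT

/-!
The model is a realizability model. The realizers are the terms of combinatory logic up to
convertibility, together with uninterpreted codes for types. A context is a set in which each
element has at least one realizer, and a substitution is a function tracked by a realizer. A type
of level `ℓ` over `Γ` assigns to each element of `Γ` a partial equivalence relation (PER) on
realizers, and is itself tracked by a realizer that computes a code of level `ℓ` for this PER. A
term picks an equivalence class of each of these PERs, again in a tracked way. Substitution is
precomposition, so most of the stability laws hold by definition.

The codes are interpreted by an inductively defined relation `Dec ℓ c R`, "the code `c` of level
`ℓ` denotes the PER `R`", which is built by recursion on `ℓ`: the universe `U ℓ` of level `ℓ + 1`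
is the PER that relates two codes of level `ℓ` with the same denotation. Being an impredicative
inductive predicate, this needs no universe of types beyond `Type`. It is single-valued
(`Decodes.eq`) because the formation of codes is injective up to convertibility (`Rz.code_inj`),
which is a consequence of the Church–Rosser property.

Functions out of a universe are constant because of erasure. There is an endomorphism `erase ℓ`
of the algebra of realizers that replaces every code of level at least `ℓ` by a dummy. All codes
of level `ℓ` have the same erasure under `erase ℓ` (`Decodes.erase_eq_star`), whereas the PER of
a type of level `ℓ` cannot tell a realizer from its erasure under `erase ℓ` (`Dec.isPer`). If `r`
tracks `f : U ℓ → A` and `c`, `d` are codes of level `ℓ`, then `r c` and `r d` have the same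
erasure, and hence realize the same element of `A`. For the booleans and the numerals, invariance
under erasure must not enlarge the set of realizers, as these types are eliminated into types of
higher levels; this holds because erasure reflects reductions (`Term.Par.of_erase`,
`Rz.Pure.erase_eq_iff`).

Identity types are interpreted by equality of elements, and the lifting of a type to the next
level keeps its PER and changes its code only.
-/

open CategoryTheory

namespace ErasureModel

/-! ### Combinatory terms with codes, and their reduction -/

/-- The type constructors without arguments. -/
inductive BaseTag
  | unit | empty | bool | nat | univ

/-- The type constructors; `up` is the lifting of a code to the next level. -/
inductive Tag
  | base (b : BaseTag) | pi | sigma | ident | up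

/-- Terms of combinatory logic with codes. `code ℓ g x` is an inert code of level `ℓ` for a type
with head constructor `g` and arguments `x`, and `mk ℓ g` is a combinator that forms such codes:
`mk ℓ g x` reduces to `code ℓ g x`. The inert term `star` replaces erased codes. -/
inductive Term
  | S | K | star
  | mk (ℓ : ℕ) (g : Tag)
  | code (ℓ : ℕ) (g : Tag) (x : Term)
  | app (f a : Term)

namespace Term

/-- Parallel reduction. -/
inductive Par : Term → Term → Prop
  | S : Par S S
  | K : Par K K
  | star : Par star star
  | mk (ℓ g) : Par (mk ℓ g) (mk ℓ g)
  | code {ℓ g x x'} : Par x x' → Par (code ℓ g x) (code ℓ g x')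
  | app {f f' a a'} : Par f f' → Par a a' → Par (app f a) (app f' a')
  | redK {x x'} (y : Term) : Par x x' → Par (app (app K x) y) x'
  | redS {x x' y y' z z'} : Par x x' → Par y y' → Par z z' →
      Par (app (app (app S x) y) z) (app (app x' z') (app y' z'))
  | redMk {ℓ g x x'} : Par x x' → Par (app (mk ℓ g) x) (code ℓ g x')

theorem Par.refl : ∀ t : Term, Par t t
  | .S => .S
  | .K => .K
  | .star => .star
  | .mk _ _ => .mk _ _
  | .code _ _ x => .code (Par.refl x)
  | .app f a => .app (Par.refl f) (Par.refl a)

/-- The complete development: all redexes of a term contracted at once. -/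
def dev : Term → Term
  | .app (.app .K x) _ => dev x
  | .app (.app (.app .S x) y) z => .app (.app (dev x) (dev z)) (.app (dev y) (dev z))
  | .app (.mk ℓ g) x => .code ℓ g (dev x)
  | .app f a => .app (dev f) (dev a)
  | .code ℓ g x => .code ℓ g (dev x)
  | t => t

theorem Par.to_dev {t u : Term} (h : Par t u) : Par u (dev t) := by
  induction t using dev.induct generalizing u with
  | case1 x y ih =>
    rw [dev]
    cases h with
    | app hf ha =>
      cases hf with
      | app hk hx => cases hk; exact .redK _ (ih hx)
    | redK _ hx => exact ih hx
  | case2 x y z ihx ihz ihy =>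
    rw [dev]
    cases h with
    | app hf hz =>
      cases hf with
      | app hf hy =>
        cases hf with
        | app hs hx => cases hs; exact .redS (ihx hx) (ihy hy) (ihz hz)
    | redS hx hy hz => exact .app (.app (ihx hx) (ihz hz)) (.app (ihy hy) (ihz hz))
  | case3 ℓ g x ih =>
    rw [dev]
    cases h with
    | app hf hx => cases hf; exact .redMk (ih hx)
    | redMk hx => exact .code (ih hx)
  | case4 f a h1 h2 h3 ihf iha =>
    rw [dev]
    · cases h with
      | app hf ha => exact .app (ihf hf) (iha ha)
      | redK => exact (h1 _ rfl).elim
      | redS => exact (h2 _ _ rfl).elim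
      | redMk => exact (h3 _ _ rfl).elim
    all_goals assumption
  | case5 ℓ g x ih =>
    rw [dev]
    cases h with
    | code hx => exact .code (ih hx)
  | case6 t h1 h2 h3 =>
    cases t <;> first | (cases h; exact .refl _) | simp_all

/-- Reduction in finitely many parallel steps. -/
abbrev Red : Term → Term → Prop := Relation.ReflTransGen Par

/-- The Church–Rosser property. -/
theorem join_of_eqvGen {t u : Term} (h : Relation.EqvGen Par t u) :
    Relation.Join Red t u := by
  refine (Relation.equivalence_join_reflTransGen ?_).eqvGen_iff.1
    (h.mono fun a b hab => ⟨b, .single hab, .refl⟩)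
  intro a b c hab hac
  exact ⟨dev a, .single hab.to_dev, .single hac.to_dev⟩

theorem Red.of_code {ℓ g x u} (h : Red (code ℓ g x) u) : ∃ x', Red x x' ∧ u = code ℓ g x' := by
  induction h with
  | refl => exact ⟨x, .refl, rfl⟩
  | tail _ h ih =>
    obtain ⟨x', hx, rfl⟩ := ih
    cases h with
    | code h => exact ⟨_, hx.tail h, rfl⟩

theorem Red.of_S {u} (h : Red S u) : u = S := by
  induction h with
  | refl => rfl
  | tail _ h ih => subst ih; cases h; rfl

theorem Red.of_K {u} (h : Red K u) : u = K := by
  induction h with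
  | refl => rfl
  | tail _ h ih => subst ih; cases h; rfl

/-- Replace all codes of level at least `k` by `star`. The combinators that form such codes
become `K star`, so that redexes are mapped to redexes. -/
def erase (k : ℕ) : Term → Term
  | .mk ℓ g => if ℓ < k then .mk ℓ g else .app .K .star
  | .code ℓ g x => if ℓ < k then .code ℓ g (erase k x) else .star
  | .app f a => .app (erase k f) (erase k a)
  | t => t

theorem Par.erase (k : ℕ) {t u : Term} (h : Par t u) : Par (t.erase k) (u.erase k) := by
  induction h with
  | S => exact .S
  | K => exact .K
  | star => exact .star
  | mk => exact .refl _
  | code _ ih => rw [Term.erase, Term.erase]; split_ifs; exacts [.code ih, .star]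
  | app _ _ ihf iha => exact .app ihf iha
  | redK y _ ih => exact .redK _ ih
  | redS _ _ _ ihx ihy ihz => exact .redS ihx ihy ihz
  | redMk _ ih => simp only [Term.erase]; split_ifs; exacts [.redMk ih, .redK _ .star]

theorem erase_erase {j k : ℕ} (h : j ≤ k) (t : Term) : (t.erase k).erase j = t.erase j := by
  induction t with
  | mk ℓ g => simp only [erase]; split_ifs <;> simp [erase] <;> omega
  | code ℓ g x ih => simp only [erase]; split_ifs <;> simp [erase, ih] <;> omega
  | app f a ihf iha => simp [erase, ihf, iha]
  | _ => rfl

theorem eq_S_of_erase {k : ℕ} {t : Term} (h : t.erase k = S) : t = S := by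
  cases t <;> simp only [erase] at h ⊢ <;> (try split_ifs at h) <;> cases h

theorem eq_K_of_erase {k : ℕ} {t : Term} (h : t.erase k = K) : t = K := by
  cases t <;> simp only [erase] at h ⊢ <;> (try split_ifs at h) <;> cases h

theorem eq_mk_of_erase {k ℓ : ℕ} {g : Tag} {t : Term} (h : t.erase k = mk ℓ g) :
    t = mk ℓ g ∧ ℓ < k := by
  cases t <;> simp only [erase] at h ⊢ <;> (try split_ifs at h) <;> cases h
  exact ⟨rfl, ‹_›⟩

theorem eq_code_of_erase {k ℓ : ℕ} {g : Tag} {x t : Term} (h : t.erase k = code ℓ g x) :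
    ∃ x', t = code ℓ g x' ∧ ℓ < k ∧ x'.erase k = x := by
  cases t <;> simp only [erase] at h ⊢ <;> (try split_ifs at h) <;> cases h
  exact ⟨_, rfl, ‹_›, rfl⟩

theorem eq_app_of_erase {k : ℕ} {f a t : Term} (h : t.erase k = app f a) :
    (∃ f' a', t = app f' a' ∧ f'.erase k = f ∧ a'.erase k = a) ∨
      f = K ∧ a = star ∧ ∃ ℓ g, t = mk ℓ g ∧ ¬ ℓ < k := by
  cases t <;> simp only [erase] at h ⊢ <;> (try split_ifs at h) <;> cases h
  · exact .inr ⟨rfl, rfl, _, _, rfl, ‹_›⟩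
  · exact .inl ⟨_, _, rfl, rfl, rfl⟩

/-- Erasure creates no redexes: each reduction of an erased term is the erasure of a reduction. -/
theorem Par.of_erase {k : ℕ} {v u : Term} (h : Par v u) :
    ∀ t : Term, t.erase k = v → ∃ t', Par t t' ∧ t'.erase k = u := by
  induction h with
  | S => exact fun t ht => ⟨t, .refl t, ht⟩
  | K => exact fun t ht => ⟨t, .refl t, ht⟩
  | star => exact fun t ht => ⟨t, .refl t, ht⟩
  | mk => exact fun t ht => ⟨t, .refl t, ht⟩
  | code _ ih =>
    intro t ht
    obtain ⟨y, rfl, hk, hy⟩ := eq_code_of_erase ht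
    obtain ⟨y', hy, rfl⟩ := ih y hy
    exact ⟨_, .code hy, by simp [Term.erase, hk]⟩
  | app h₁ h₂ ihf iha =>
    intro t ht
    obtain ⟨f, a, rfl, hf, ha⟩ | ⟨rfl, rfl, ℓ, g, rfl, hk⟩ := eq_app_of_erase ht
    · obtain ⟨f', hf, rfl⟩ := ihf _ hf
      obtain ⟨a', ha, rfl⟩ := iha _ ha
      exact ⟨_, .app hf ha, rfl⟩
    · cases h₁; cases h₂
      exact ⟨_, .refl _, ht⟩
  | redK y h ih =>
    intro t ht
    obtain ⟨f, a, rfl, hf, ha⟩ | ⟨h, -⟩ := eq_app_of_erase ht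
    · obtain ⟨f', a', rfl, hf, ha⟩ | ⟨-, rfl, ℓ, g, rfl, hk⟩ := eq_app_of_erase hf
      · obtain rfl := eq_K_of_erase hf
        obtain ⟨a', ha, rfl⟩ := ih _ ha
        exact ⟨_, .redK _ ha, rfl⟩
      · cases h
        exact ⟨_, .redMk (.refl a), by simp [Term.erase, hk]⟩
    · cases h
  | redS _ _ _ ihx ihy ihz =>
    intro t ht
    obtain ⟨f, z, rfl, hf, hz⟩ | ⟨h, -⟩ := eq_app_of_erase ht
    · obtain ⟨f, y, rfl, hf, hy⟩ | ⟨h, -⟩ := eq_app_of_erase hf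
      · obtain ⟨f, x, rfl, hf, hx⟩ | ⟨h, -⟩ := eq_app_of_erase hf
        · obtain rfl := eq_S_of_erase hf
          obtain ⟨x', hx, rfl⟩ := ihx _ hx
          obtain ⟨y', hy, rfl⟩ := ihy _ hy
          obtain ⟨z', hz, rfl⟩ := ihz _ hz
          exact ⟨_, .redS hx hy hz, rfl⟩
        · cases h
      · cases h
    · cases h
  | redMk _ ih =>
    intro t ht
    obtain ⟨f, a, rfl, hf, ha⟩ | ⟨h, -⟩ := eq_app_of_erase ht
    · obtain ⟨rfl, hk⟩ := eq_mk_of_erase hf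
      obtain ⟨a', ha, rfl⟩ := ih _ ha
      exact ⟨_, .redMk ha, by simp [Term.erase, hk]⟩
    · cases h

theorem Red.of_erase {k : ℕ} {t u : Term} (h : Red (t.erase k) u) :
    ∃ t', Red t t' ∧ t'.erase k = u := by
  induction h with
  | refl => exact ⟨t, .refl, rfl⟩
  | tail _ h ih =>
    obtain ⟨t', ht, rfl⟩ := ih
    obtain ⟨t'', ht', rfl⟩ := h.of_erase t' rfl
    exact ⟨t'', ht.tail ht', rfl⟩

/-- The pure terms: those built from `S` and `K` alone. -/
inductive Pure : Term → Prop
  | S : Pure S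
  | K : Pure K
  | app {f a} : Pure f → Pure a → Pure (app f a)

theorem Pure.par {t u : Term} (ht : Pure t) (h : Par t u) : Pure u := by
  induction h with
  | S => exact .S
  | K => exact .K
  | star => exact ht
  | mk => exact ht
  | code => cases ht
  | app _ _ ihf iha => cases ht with | app hf ha => exact .app (ihf hf) (iha ha)
  | redK y _ ih => cases ht with | app hf _ => cases hf with | app _ hx => exact ih hx
  | redS _ _ _ ihx ihy ihz =>
    cases ht with
    | app hf hz =>
      cases hf with
      | app hf hy =>
        cases hf with
        | app _ hx => exact .app (.app (ihx hx) (ihz hz)) (.app (ihy hy) (ihz hz))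
  | redMk => cases ht with | app hf _ => cases hf

theorem Pure.red {t u : Term} (ht : Pure t) (h : Red t u) : Pure u := by
  induction h with
  | refl => exact ht
  | tail _ h ih => exact ih.par h

theorem Pure.erase {t : Term} (ht : Pure t) (k : ℕ) : t.erase k = t := by
  induction ht with
  | S => rfl
  | K => rfl
  | app _ _ ihf iha => rw [Term.erase, ihf, iha]

theorem Pure.eq_of_erase {k : ℕ} {t u : Term} (ht : Pure t) (h : u.erase k = t) : u = t := by
  induction ht generalizing u with
  | S => exact eq_S_of_erase h
  | K => exact eq_K_of_erase h
  | app _ ha ihf iha =>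
    obtain ⟨f, a, rfl, hf, ha⟩ | ⟨-, rfl, -⟩ := eq_app_of_erase h
    · rw [ihf hf, iha ha]
    · cases ha

end Term

/-! ### The algebra of realizers -/

/-- Realizers: terms up to convertibility. -/
def Rz : Type := Quot Term.Par

namespace Rz

/-- Application of realizers. -/
def app : Rz → Rz → Rz :=
  Quot.map₂ Term.app (fun f _ _ h => .app (.refl f) h) (fun _ _ a h => .app h (.refl a))

instance : CoeFun Rz fun _ => Rz → Rz := ⟨app⟩

def S : Rz := Quot.mk _ .S
def K : Rz := Quot.mk _ .K
def star : Rz := Quot.mk _ .star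
def mk (ℓ : ℕ) (g : Tag) : Rz := Quot.mk _ (.mk ℓ g)
def code (ℓ : ℕ) (g : Tag) : Rz → Rz := Quot.map (Term.code ℓ g) fun _ _ h => .code h
/-- The endomorphism of the algebra of realizers that erases all codes of level at least `k`. -/
def erase (k : ℕ) : Rz → Rz := Quot.map (Term.erase k) fun _ _ h => h.erase k

@[simp] theorem K_app (x y : Rz) : K x y = x := by
  induction x using Quot.ind; induction y using Quot.ind
  exact Quot.sound (.redK _ (.refl _))

@[simp] theorem S_app (x y z : Rz) : S x y z = x z (y z) := by
  induction x using Quot.ind; induction y using Quot.ind; induction z using Quot.ind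
  exact Quot.sound (.redS (.refl _) (.refl _) (.refl _))

@[simp] theorem mk_app (ℓ : ℕ) (g : Tag) (x : Rz) : mk ℓ g x = code ℓ g x := by
  induction x using Quot.ind
  exact Quot.sound (.redMk (.refl _))

@[simp] theorem erase_app (k : ℕ) (f a : Rz) : erase k (f a) = (erase k f) (erase k a) := by
  induction f using Quot.ind; induction a using Quot.ind; rfl

theorem erase_code_of_lt {k ℓ : ℕ} (h : ℓ < k) (g : Tag) (x : Rz) :
    erase k (code ℓ g x) = code ℓ g (erase k x) := by
  induction x using Quot.ind
  exact congrArg (Quot.mk _) (if_pos h)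

theorem erase_code_of_le {k ℓ : ℕ} (h : k ≤ ℓ) (g : Tag) (x : Rz) :
    erase k (code ℓ g x) = star := by
  induction x using Quot.ind
  exact congrArg (Quot.mk _) (if_neg h.not_gt)

theorem erase_erase {j k : ℕ} (h : j ≤ k) (x : Rz) : erase j (erase k x) = erase j x := by
  induction x using Quot.ind
  exact congrArg (Quot.mk _) (Term.erase_erase h _)

theorem join_of_eq {t u : Term} (h : (Quot.mk _ t : Rz) = Quot.mk _ u) :
    Relation.Join Term.Red t u := Term.join_of_eqvGen (Quot.eqvGen_exact h)

theorem mk_eq_of_red {t u : Term} (h : Term.Red t u) : (Quot.mk _ t : Rz) = Quot.mk _ u := by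
  induction h with
  | refl => rfl
  | tail _ h ih => exact ih.trans (Quot.sound h)

theorem code_inj {ℓ ℓ' : ℕ} {g g' : Tag} {x x' : Rz} (h : code ℓ g x = code ℓ' g' x') :
    ℓ = ℓ' ∧ g = g' ∧ x = x' := by
  induction x using Quot.ind; induction x' using Quot.ind
  obtain ⟨u, h₁, h₂⟩ := join_of_eq h
  obtain ⟨y, hy, rfl⟩ := h₁.of_code
  obtain ⟨y', hy', h⟩ := h₂.of_code
  cases h
  exact ⟨rfl, rfl, (mk_eq_of_red hy).trans (mk_eq_of_red hy').symm⟩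

theorem S_ne_K : S ≠ K := by
  intro h
  obtain ⟨u, h₁, h₂⟩ := join_of_eq h
  cases h₁.of_S.symm.trans h₂.of_K

/-- The pure realizers: those built from `S` and `K` alone. -/
inductive Pure : Rz → Prop
  | S : Pure S
  | K : Pure K
  | app {f a} : Pure f → Pure a → Pure (f a)

theorem Pure.exists_term {x : Rz} (hx : Pure x) : ∃ t : Term, t.Pure ∧ x = Quot.mk _ t := by
  induction hx with
  | S => exact ⟨_, .S, rfl⟩
  | K => exact ⟨_, .K, rfl⟩
  | app _ _ ihf iha =>
    obtain ⟨f, hf, rfl⟩ := ihf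
    obtain ⟨a, ha, rfl⟩ := iha
    exact ⟨_, .app hf ha, rfl⟩

theorem Pure.erase {x : Rz} (hx : Pure x) (k : ℕ) : erase k x = x := by
  obtain ⟨t, ht, rfl⟩ := hx.exists_term
  exact congrArg (Quot.mk _) (ht.erase k)

/-- Only a pure realizer itself erases to it. Hence the booleans and the numerals are stable
under erasure although they can be eliminated into types of all levels. -/
theorem Pure.erase_eq_iff {x : Rz} (hx : Pure x) {k : ℕ} {y : Rz} : Rz.erase k y = x ↔ y = x := by
  refine ⟨fun h => ?_, fun h => h ▸ hx.erase k⟩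
  obtain ⟨t, ht, rfl⟩ := hx.exists_term
  induction y using Quot.ind with | mk u =>
  obtain ⟨v, h₁, h₂⟩ := join_of_eq h
  obtain ⟨u', hu, rfl⟩ := h₁.of_erase
  have hp := ht.red h₂
  rw [← hp.eq_of_erase rfl] at h₂
  exact (mk_eq_of_red hu).trans (mk_eq_of_red h₂).symm

/-! ### Pairs, currying, booleans and numerals -/

def I : Rz := S K K

/-- Composition of the functions given by two realizers. -/
def comp (f g : Rz) : Rz := S (K f) g

/-- `cons a f s z = z a (f s z)`, the common part of pairing and of the successor. -/
def cons : Rz := S (K S) (S (K K) (S (K S) (S (K (S I)) K)))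

/-- Church pairing: `pair a b z = z a b`. -/
def pair : Rz := S cons (K K)

def fst : Rz := S I (K K)
def snd : Rz := S I (K (K I))

/-- Currying: `cur f x y = f (pair x y)`. -/
def cur (f : Rz) : Rz := S (K (S (K f))) pair

def tt : Rz := K
def ff : Rz := K I

/-- `succ n z s = s n (n z s)`, the successor of numerals that are recursors. -/
def succ : Rz := S cons I

/-- The numeral `num n` is the primitive recursor: `num (n + 1) z s = s (num n) (num n z s)`. -/
def num : ℕ → Rz
  | 0 => K
  | n + 1 => succ (num n)

@[simp] theorem I_app (x : Rz) : I x = x := by simp [I]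
@[simp] theorem comp_app (f g x : Rz) : comp f g x = f (g x) := by simp [comp]
@[simp] theorem fst_pair (x y : Rz) : fst (pair x y) = x := by simp [fst, pair, cons]
@[simp] theorem snd_pair (x y : Rz) : snd (pair x y) = y := by simp [snd, pair, cons]
@[simp] theorem cur_app (f x y : Rz) : cur f x y = f (pair x y) := by simp [cur]
@[simp] theorem tt_app (x y : Rz) : tt x y = x := by simp [tt]
@[simp] theorem ff_app (x y : Rz) : ff x y = y := by simp [ff]
@[simp] theorem num_zero_app (z s : Rz) : num 0 z s = z := by simp [num]
@[simp] theorem num_succ_app (n : ℕ) (z s : Rz) : num (n + 1) z s = s (num n) (num n z s) := by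
  simp [num, succ, cons]

theorem pure_I : Pure I := .app (.app .S .K) .K
theorem pure_cons : Pure cons := by
  have := pure_I
  unfold cons
  repeat first | assumption | constructor
theorem pure_pair : Pure pair := .app (.app .S pure_cons) (.app .K .K)
theorem pure_fst : Pure fst := .app (.app .S pure_I) (.app .K .K)
theorem pure_snd : Pure snd := .app (.app .S pure_I) (.app .K (.app .K pure_I))
theorem pure_tt : Pure tt := .K
theorem pure_ff : Pure ff := .app .K pure_I
theorem pure_num : ∀ n, Pure (num n)
  | 0 => .K
  | n + 1 => .app (.app (.app .S pure_cons) pure_I) (pure_num n)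

@[simp] theorem erase_pair (k : ℕ) : erase k pair = pair := pure_pair.erase k
theorem pair_inj {x y x' y' : Rz} (h : pair x y = pair x' y') : x = x' ∧ y = y' :=
  ⟨by rw [← fst_pair x y, h, fst_pair], by rw [← snd_pair x y, h, snd_pair]⟩

theorem tt_ne_ff : tt ≠ ff := fun h => S_ne_K <| by rw [← tt_app S K, h, ff_app]

theorem num_inj : ∀ {m n : ℕ}, num m = num n → m = n
  | 0, 0, _ => rfl
  -- Applied to `S` and `K (K K)`, zero gives `S` and successors give `K`.
  | 0, n + 1, h => (S_ne_K <| by rw [← num_zero_app S (K (K K)), h]; simp).elim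
  | m + 1, 0, h => (S_ne_K <| by rw [← num_zero_app S (K (K K)), ← h]; simp).elim
  | m + 1, n + 1, h => congrArg (· + 1) <| num_inj <| by
      -- Recursion with step `K` computes the predecessor.
      have := congrArg (fun x : Rz => x S K) h
      simpa using this

end Rz

/-! ### Partial equivalence relations invariant under erasure -/

open Rz

/-- Relations on realizers. -/
abbrev Rel : Type := Rz → Rz → Prop

/-- A partial equivalence relation that does not distinguish a realizer from its erasure. -/
structure IsPer (k : ℕ) (R : Rel) : Prop where
  symm : ∀ {x y}, R x y → R y x
  trans : ∀ {x y z}, R x y → R y z → R x z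
  erase_left : ∀ {x y}, R (erase k x) y ↔ R x y

namespace IsPer

variable {k : ℕ} {R : Rel} {x y : Rz}

theorem left (h : IsPer k R) (hxy : R x y) : R x x := h.trans hxy (h.symm hxy)

theorem right (h : IsPer k R) (hxy : R x y) : R y y := h.trans (h.symm hxy) hxy

theorem erase_right (h : IsPer k R) : R x (erase k y) ↔ R x y :=
  ⟨fun H => h.symm (h.erase_left.1 (h.symm H)), fun H => h.symm (h.erase_left.2 (h.symm H))⟩

theorem congr (h : IsPer k R) {x' y' : Rz} (hx : erase k x = erase k x')
    (hy : erase k y = erase k y') : R x y ↔ R x' y' := by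
  rw [← h.erase_left, ← h.erase_right, hx, hy, h.erase_left, h.erase_right]

theorem mono (h : IsPer k R) {k' : ℕ} (hk : k ≤ k') : IsPer k' R where
  symm := h.symm
  trans := h.trans
  erase_left := h.congr (erase_erase hk _) rfl

/-- The equivalence classes of related realizers are equal. -/
theorem class_eq (h : IsPer k R) (hxy : R x y) : R x = R y :=
  funext fun _ => propext ⟨h.trans (h.symm hxy), h.trans hxy⟩

end IsPer

/-- The PER of dependent functions; the fibre of `F` is indexed by the realizers of `A`. -/
def piRel (A : Rel) (F : Rz → Rel) : Rel := fun f g => ∀ a b, A a b → F a (f a) (g b)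

/-- The PER of dependent pairs. -/
def sigmaRel (A : Rel) (F : Rz → Rel) : Rel := fun p q =>
  A (fst p) (fst q) ∧ F (fst p) (snd p) (snd q)

/-- The PER of codes interpreted by `P`: two codes are equal if they denote the same relation. -/
def univRel (P : Rz → Rel → Prop) : Rel := fun c d => ∃ R, P c R ∧ P d R

def boolRel : Rel := fun u v => (u = tt ∧ v = tt) ∨ (u = ff ∧ v = ff)

def natRel : Rel := fun u v => ∃ n, u = num n ∧ v = num n

def baseRel (P : Rz → Rel → Prop) : BaseTag → Rel
  | .unit => fun _ _ => True
  | .empty => fun _ _ => False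
  | .bool => boolRel
  | .nat => natRel
  | .univ => univRel P

/-! ### Codes of types -/

/-- `Decodes ℓ P c R`: the realizer `c` is a code of level `ℓ` for the relation `R`, where `P`
interprets the codes of the level below, which can be lifted and which form the universe of level
`ℓ`. A code is only inspected up to `erase (ℓ + 1)`, which keeps the codes of level `ℓ`. Codes
without arguments carry the dummy argument `K`. -/
inductive Decodes (ℓ : ℕ) (P : Rz → Rel → Prop) : Rz → Rel → Prop
  | base {c} {b : BaseTag} :
      erase (ℓ + 1) c = code ℓ (.base b) K → Decodes ℓ P c (baseRel P b)
  | up {c a A} : erase (ℓ + 1) c = code ℓ .up (erase (ℓ + 1) a) → P a A → Decodes ℓ P c A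
  | pi {c a b A} {F : Rz → Rel} :
      erase (ℓ + 1) c = code ℓ .pi (erase (ℓ + 1) (pair a b)) → Decodes ℓ P a A →
      (∀ x, A x x → Decodes ℓ P (b x) (F x)) → (∀ x y, A x y → F x = F y) →
      Decodes ℓ P c (piRel A F)
  | sigma {c a b A} {F : Rz → Rel} :
      erase (ℓ + 1) c = code ℓ .sigma (erase (ℓ + 1) (pair a b)) → Decodes ℓ P a A →
      (∀ x, A x x → Decodes ℓ P (b x) (F x)) → (∀ x y, A x y → F x = F y) →
      Decodes ℓ P c (sigmaRel A F)
  | ident {c a x y A} :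
      erase (ℓ + 1) c = code ℓ .ident (erase (ℓ + 1) (pair a (pair x y))) → Decodes ℓ P a A →
      Decodes ℓ P c (fun _ _ => A x y)

/-- The properties that the interpretation `P` of codes needs: it is single-valued and invariant
under erasure, and its values are partial equivalence relations. -/
structure Decoding (k : ℕ) (P : Rz → Rel → Prop) : Prop where
  eq : ∀ {c c' R R'}, erase k c = erase k c' → P c R → P c' R' → R = R'
  erase_iff : ∀ {c R}, P (erase k c) R ↔ P c R
  isPer : ∀ {c R}, P c R → IsPer k R

theorem isPer_piRel {k : ℕ} {A : Rel} {F : Rz → Rel} (hA : IsPer k A)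
    (hF : ∀ x, A x x → IsPer k (F x)) (hF' : ∀ x y, A x y → F x = F y) :
    IsPer k (piRel A F) where
  symm h a b hab := (hF a (hA.left hab)).symm (hF' _ _ hab ▸ h b a (hA.symm hab))
  trans h h' a b hab := (hF a (hA.left hab)).trans (h a a (hA.left hab)) (h' a b hab)
  erase_left {f g} := by
    have key : ∀ f, (∀ a b, A a b → F a (f a) (g b)) →
        ∀ a b, A a b → F a ((erase k f) a) (g b) := by
      intro f h a b hab
      have haa := hA.left hab
      rw [← (hF a haa).erase_left, erase_app, erase_erase le_rfl, ← erase_app,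
        (hF a haa).erase_left]
      exact h a b hab
    refine ⟨fun h a b hab => ?_, key f⟩
    have haa := hA.left hab
    have := key _ h a b hab
    rw [← (hF a haa).erase_left, erase_app, erase_erase le_rfl, erase_erase le_rfl,
      ← erase_app, (hF a haa).erase_left] at this
    exact this

theorem isPer_sigmaRel {k : ℕ} {A : Rel} {F : Rz → Rel} (hA : IsPer k A)
    (hF : ∀ x, A x x → IsPer k (F x)) (hF' : ∀ x y, A x y → F x = F y) :
    IsPer k (sigmaRel A F) where
  symm h := ⟨hA.symm h.1, hF' _ _ h.1 ▸ (hF _ (hA.left h.1)).symm h.2⟩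
  trans h h' := ⟨hA.trans h.1 h'.1,
    (hF _ (hA.left h.1)).trans h.2 (hF' _ _ h.1 ▸ h'.2)⟩
  erase_left {p q} := by
    have h₁ : erase k (fst (erase k p)) = erase k (fst p) := by simp [erase_erase le_rfl]
    have h₂ : erase k (snd (erase k p)) = erase k (snd p) := by simp [erase_erase le_rfl]
    unfold sigmaRel
    rw [hA.congr h₁ rfl]
    refine and_congr_right fun h => ?_
    have hp := hA.left h
    rw [hF' (fst (erase k p)) (fst p) ((hA.congr h₁ rfl).2 hp)]
    exact (hF _ hp).congr h₂ rfl

theorem isPer_boolRel (k : ℕ) : IsPer k boolRel where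
  symm := by rintro x y (⟨rfl, rfl⟩ | ⟨rfl, rfl⟩) <;> simp [boolRel]
  trans := by
    rintro x y z (⟨rfl, rfl⟩ | ⟨rfl, rfl⟩) h
    · exact h
    · exact h
  erase_left := by simp only [boolRel, pure_tt.erase_eq_iff, pure_ff.erase_eq_iff, implies_true]

theorem num_class {n m : ℕ} : natRel (num n) (num m) ↔ n = m :=
  ⟨fun ⟨_, h, h'⟩ => (num_inj h).trans (num_inj h').symm, fun h => ⟨n, rfl, h ▸ rfl⟩⟩

theorem isPer_natRel (k : ℕ) : IsPer k natRel where
  symm := fun ⟨n, h, h'⟩ => ⟨n, h', h⟩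
  trans := by
    rintro x y z ⟨n, rfl, rfl⟩ h
    exact h
  erase_left := by simp only [natRel, (pure_num _).erase_eq_iff, implies_true]

theorem Decoding.isPer_univRel {k : ℕ} {P : Rz → Rel → Prop} (hP : Decoding k P) :
    IsPer k (univRel P) where
  symm := fun ⟨R, h, h'⟩ => ⟨R, h', h⟩
  trans := fun ⟨R, h₁, h₂⟩ ⟨R', h₃, h₄⟩ => ⟨R, h₁, hP.eq rfl h₃ h₂ ▸ h₄⟩
  erase_left := by simp only [univRel, hP.erase_iff, implies_true]

theorem Decoding.isPer_baseRel {k : ℕ} {P : Rz → Rel → Prop} (hP : Decoding k P) :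
    ∀ b, IsPer k (baseRel P b)
  | .unit => ⟨fun h => h, fun h _ => h, Iff.rfl⟩
  | .empty => ⟨fun h => h, fun h _ => h, Iff.rfl⟩
  | .bool => isPer_boolRel k
  | .nat => isPer_natRel k
  | .univ => hP.isPer_univRel

/-- The denotation of a code of level `ℓ` is invariant under erasure at `ℓ`, one level lower than
what the code itself is invariant under. -/
theorem Decodes.isPer {ℓ : ℕ} {P : Rz → Rel → Prop} (hP : Decoding ℓ P) {c R}
    (h : Decodes ℓ P c R) : IsPer ℓ R := by
  induction h with
  | base _ => exact hP.isPer_baseRel _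
  | up _ h => exact hP.isPer h
  | pi _ _ _ h' ih ih' => exact isPer_piRel ih ih' h'
  | sigma _ _ _ h' ih ih' => exact isPer_sigmaRel ih ih' h'
  | ident => exact ⟨fun h => h, fun h _ => h, Iff.rfl⟩

theorem Decodes.eq {ℓ : ℕ} {P : Rz → Rel → Prop} (hP : Decoding ℓ P) {c c' R R'}
    (hc : erase (ℓ + 1) c = erase (ℓ + 1) c') (h : Decodes ℓ P c R) (h' : Decodes ℓ P c' R') :
    R = R' := by
  induction h generalizing c' R' with
  | base h =>
    cases h' with
    | base h' => cases (code_inj (h.symm.trans (hc.trans h'))).2.1; rfl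
    | _ h' => cases (code_inj (h.symm.trans (hc.trans h'))).2.1
  | up h hA =>
    cases h' with
    | up h' hA' =>
      -- The code before lifting is only known up to `erase (ℓ + 1)`, which `P` does not see.
      have := congrArg (erase ℓ) (code_inj (h.symm.trans (hc.trans h'))).2.2
      rw [erase_erase ℓ.le_succ, erase_erase ℓ.le_succ] at this
      exact hP.eq this hA hA'
    | _ h' => cases (code_inj (h.symm.trans (hc.trans h'))).2.1
  | pi h hA hB hF ihA ihB =>
    cases h' with
    | pi h' hA' hB' hF' =>
      have := (code_inj (h.symm.trans (hc.trans h'))).2.2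
      simp only [erase_app, erase_pair] at this
      obtain ⟨ha, hb⟩ := pair_inj this
      obtain rfl := ihA ha hA'
      funext f g
      refine propext (forall_congr' fun x => forall_congr' fun y => forall_congr' fun hxy => ?_)
      have hx := (hA.isPer hP).left hxy
      rw [ihB x hx (by rw [erase_app, hb, ← erase_app]) (hB' x hx)]
    | _ h' => cases (code_inj (h.symm.trans (hc.trans h'))).2.1
  | sigma h hA hB hF ihA ihB =>
    cases h' with
    | sigma h' hA' hB' hF' =>
      have := (code_inj (h.symm.trans (hc.trans h'))).2.2
      simp only [erase_app, erase_pair] at this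
      obtain ⟨ha, hb⟩ := pair_inj this
      obtain rfl := ihA ha hA'
      funext p q
      refine propext (and_congr_right fun h => ?_)
      have hx := (hA.isPer hP).left h
      rw [ihB _ hx (by rw [erase_app, hb, ← erase_app]) (hB' _ hx)]
    | _ h' => cases (code_inj (h.symm.trans (hc.trans h'))).2.1
  | ident h hA ihA =>
    cases h' with
    | ident h' hA' =>
      have := (code_inj (h.symm.trans (hc.trans h'))).2.2
      simp only [erase_app, erase_pair] at this
      obtain ⟨ha, hxy⟩ := pair_inj this
      obtain ⟨hx, hy⟩ := pair_inj hxy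
      obtain rfl := ihA ha hA'
      funext _ _
      exact propext (((hA.isPer hP).mono ℓ.le_succ).congr hx hy)
    | _ h' => cases (code_inj (h.symm.trans (hc.trans h'))).2.1

theorem Decodes.congr {ℓ : ℕ} {P : Rz → Rel → Prop} {c c' R}
    (hc : erase (ℓ + 1) c = erase (ℓ + 1) c') (h : Decodes ℓ P c R) : Decodes ℓ P c' R := by
  cases h with
  | base h => exact .base (hc.symm.trans h)
  | up h hA => exact .up (hc.symm.trans h) hA
  | pi h hA hB hF => exact .pi (hc.symm.trans h) hA hB hF
  | sigma h hA hB hF => exact .sigma (hc.symm.trans h) hA hB hF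
  | ident h hA => exact .ident (hc.symm.trans h) hA

/-- All codes of level `ℓ` are indistinguishable after erasure at `ℓ`. -/
theorem Decodes.erase_eq_star {ℓ : ℕ} {P : Rz → Rel → Prop} {c R}
    (h : Decodes ℓ P c R) : erase ℓ c = star := by
  rw [← erase_erase ℓ.le_succ]
  cases h <;> simp only [*, erase_code_of_le le_rfl]

theorem Decodes.decoding {ℓ : ℕ} {P : Rz → Rel → Prop} (hP : Decoding ℓ P) :
    Decoding (ℓ + 1) (Decodes ℓ P) where
  eq := Decodes.eq hP
  erase_iff := ⟨.congr (erase_erase le_rfl _), .congr (erase_erase le_rfl _).symm⟩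
  isPer h := (h.isPer hP).mono ℓ.le_succ

/-- The interpretation of the codes of the level just below `ℓ`; there are none for `ℓ = 0`. -/
def Below : ℕ → Rz → Rel → Prop
  | 0 => fun _ _ => False
  | ℓ + 1 => Decodes ℓ (Below ℓ)

/-- `Dec ℓ c R`: the realizer `c` is a code of level `ℓ` for the relation `R`. -/
abbrev Dec (ℓ : ℕ) : Rz → Rel → Prop := Decodes ℓ (Below ℓ)

theorem decoding_below : ∀ ℓ, Decoding ℓ (Below ℓ)
  | 0 => ⟨fun _ h => h.elim, Iff.rfl, fun h => h.elim⟩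
  | ℓ + 1 => Decodes.decoding (decoding_below ℓ)

variable {ℓ m n : ℕ} {c c' : Rz} {R R' A : Rel} {F : Rz → Rel}

theorem Dec.isPer (h : Dec ℓ c R) : IsPer ℓ R := Decodes.isPer (decoding_below ℓ) h

theorem Dec.eq (h : Dec ℓ c R) (h' : Dec ℓ c R') : R = R' :=
  Decodes.eq (decoding_below ℓ) rfl h h'

theorem dec_base (ℓ : ℕ) (b : BaseTag) : Dec ℓ (code ℓ (.base b) K) (baseRel (Below ℓ) b) :=
  .base (erase_code_of_lt ℓ.lt_succ_self _ _)

theorem Dec.up (h : Dec ℓ c R) : Dec (ℓ + 1) (mk (ℓ + 1) .up c) R :=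
  Decodes.up (by rw [mk_app]; exact erase_code_of_lt (ℓ + 1).lt_succ_self _ _) h

/-- Codes can be raised to any higher level by a realizer. -/
theorem exists_up (h : m ≤ n) : ∃ r : Rz, ∀ c R, Dec m c R → Dec n (r c) R := by
  induction n, h using Nat.le_induction with
  | base => exact ⟨I, fun c R h => by rwa [I_app]⟩
  | succ n _ ih =>
    obtain ⟨r, hr⟩ := ih
    exact ⟨comp (mk (n + 1) .up) r, fun c R h => by rw [comp_app]; exact (hr c R h).up⟩

theorem Dec.pi {a b : Rz} (ha : Dec ℓ a A) (hb : ∀ x, A x x → Dec ℓ (b x) (F x))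
    (hF : ∀ x y, A x y → F x = F y) : Dec ℓ (mk ℓ .pi (pair a b)) (piRel A F) :=
  Decodes.pi (by rw [mk_app]; exact erase_code_of_lt ℓ.lt_succ_self _ _) ha hb hF

theorem Dec.sigma {a b : Rz} (ha : Dec ℓ a A) (hb : ∀ x, A x x → Dec ℓ (b x) (F x))
    (hF : ∀ x y, A x y → F x = F y) : Dec ℓ (mk ℓ .sigma (pair a b)) (sigmaRel A F) :=
  Decodes.sigma (by rw [mk_app]; exact erase_code_of_lt ℓ.lt_succ_self _ _) ha hb hF

theorem Dec.ident {a : Rz} (ha : Dec ℓ a A) (x y : Rz) :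
    Dec ℓ (mk ℓ .ident (pair a (pair x y))) (fun _ _ => A x y) :=
  Decodes.ident (by rw [mk_app]; exact erase_code_of_lt ℓ.lt_succ_self _ _) ha

/-! ### The category with families -/

open DTT DTT.LeveledCwF

/-- Assemblies: sets in which each element has a realizer. They serve as contexts. -/
structure Asm : Type 1 where
  carrier : Type
  real : Rz → carrier → Prop
  exists_real : ∀ x, ∃ a, real a x

/-- Functions between assemblies that are tracked by a realizer. -/
@[ext] structure Hom (Γ Δ : Asm) : Type where
  toFun : Γ.carrier → Δ.carrier
  tracked : ∃ r : Rz, ∀ a x, Γ.real a x → Δ.real (r a) (toFun x)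

instance : Category Asm where
  Hom := Hom
  id Γ := ⟨fun x => x, I, fun a x h => by rwa [I_app]⟩
  comp σ τ := ⟨fun x => τ.toFun (σ.toFun x), by
    obtain ⟨r, hr⟩ := σ.tracked
    obtain ⟨s, hs⟩ := τ.tracked
    exact ⟨comp s r, fun a x h => by rw [comp_app]; exact hs _ _ (hr _ _ h)⟩⟩

/-- Types of level `ℓ` over `Γ`: families of partial equivalence relations with tracked codes. -/
@[ext] structure Ty (Γ : Asm) (ℓ : ℕ) : Type where
  rel : Γ.carrier → Rel
  tracked : ∃ r : Rz, ∀ a x, Γ.real a x → Dec ℓ (r a) (rel x)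

/-- Terms of type `A`: families of equivalence classes with tracked representatives. An element
of a PER `R` is encoded as the class `R a` of some `a` with `R a a`, seen as a predicate. -/
@[ext] structure Tm {Γ : Asm} {ℓ : ℕ} (A : Ty Γ ℓ) : Type where
  val : Γ.carrier → Rz → Prop
  tracked : ∃ r : Rz, ∀ a x, Γ.real a x → A.rel x (r a) (r a) ∧ val x = A.rel x (r a)

variable {Γ Δ : Asm} {ℓ m n : ℕ}

theorem Ty.isPer (A : Ty Γ ℓ) (x : Γ.carrier) : IsPer ℓ (A.rel x) := by
  obtain ⟨a, ha⟩ := Γ.exists_real x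
  obtain ⟨r, hr⟩ := A.tracked
  exact (hr a x ha).isPer

namespace Tm

variable {A : Ty Γ ℓ}

/-- A realizer that tracks a term. -/
noncomputable def rz (t : Tm A) : Rz := t.tracked.choose

theorem rz_rel (t : Tm A) {a x} (h : Γ.real a x) : A.rel x (t.rz a) (t.rz a) :=
  (t.tracked.choose_spec a x h).1

theorem val_eq_rz (t : Tm A) {a x} (h : Γ.real a x) : t.val x = A.rel x (t.rz a) :=
  (t.tracked.choose_spec a x h).2

theorem rz_mem (t : Tm A) {a x} (h : Γ.real a x) : t.val x (t.rz a) :=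
  t.val_eq_rz h ▸ t.rz_rel h

theorem val_eq (t : Tm A) {x u} (h : t.val x u) : t.val x = A.rel x u := by
  obtain ⟨a, ha⟩ := Γ.exists_real x
  rw [t.val_eq_rz ha] at h ⊢
  exact (A.isPer x).class_eq h

theorem rel_of_val (t : Tm A) {x u v} (h : t.val x u) (h' : t.val x v) : A.rel x u v :=
  t.val_eq h ▸ h'

theorem exists_val (t : Tm A) (x) : ∃ u, t.val x u :=
  let ⟨_, ha⟩ := Γ.exists_real x
  ⟨_, t.rz_mem ha⟩

theorem isClass (t : Tm A) (x) : ∃ a, A.rel x a a ∧ t.val x = A.rel x a :=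
  let ⟨u, hu⟩ := t.exists_val x
  ⟨u, t.rel_of_val hu hu, t.val_eq hu⟩

/-- Two terms are equal if their values have a common realizer everywhere. -/
theorem ext_of_common {s t : Tm A} (h : ∀ x, ∃ u, s.val x u ∧ t.val x u) : s = t := by
  ext1
  funext x
  obtain ⟨u, hs, ht⟩ := h x
  rw [s.val_eq hs, t.val_eq ht]

/-- The term with a given realizer. -/
def ofRz (A : Ty Γ ℓ) (r : Rz)
    (h : ∀ a a' x, Γ.real a x → Γ.real a' x → A.rel x (r a) (r a')) : Tm A where
  val x u := ∃ a, Γ.real a x ∧ A.rel x (r a) u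
  tracked := ⟨r, fun a x ha => ⟨h a a x ha ha, funext fun _ => propext
    ⟨fun ⟨a', ha', hu⟩ => (A.isPer x).trans (h a a' x ha ha') hu, fun hu => ⟨a, ha, hu⟩⟩⟩⟩

theorem ofRz_mem (A : Ty Γ ℓ) (r : Rz)
    (h : ∀ a a' x, Γ.real a x → Γ.real a' x → A.rel x (r a) (r a')) {a x} (ha : Γ.real a x) :
    (ofRz A r h).val x (r a) := ⟨a, ha, h a a x ha ha⟩

theorem val_eq_of_heq {A B : Ty Γ ℓ} (h : A = B) {s : Tm A} {t : Tm B} (hst : HEq s t) :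
    s.val = t.val := by
  subst h
  cases hst
  rfl

end Tm

/-- Points of the extended context: a point of `Γ` with an element of the fibre of `A` over it. -/
@[ext] structure ExtPt (A : Ty Γ ℓ) : Type where
  base : Γ.carrier
  val : Rz → Prop
  isClass : ∃ a, A.rel base a a ∧ val = A.rel base a

/-- The extended context, realized by pairs. -/
def ext (A : Ty Γ ℓ) : Asm where
  carrier := ExtPt A
  real c w := Γ.real (fst c) w.base ∧ A.rel w.base (snd c) (snd c) ∧
    w.val = A.rel w.base (snd c)
  exists_real w := by
    obtain ⟨a, ha⟩ := Γ.exists_real w.base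
    obtain ⟨b, hb⟩ := w.isClass
    exact ⟨pair a b, by simpa using ⟨ha, hb⟩⟩

/-- Substitution in types. -/
def Ty.sub (A : Ty Δ ℓ) (σ : Γ ⟶ Δ) : Ty Γ ℓ where
  rel x := A.rel (σ.toFun x)
  tracked := by
    obtain ⟨r, hr⟩ := A.tracked
    obtain ⟨s, hs⟩ := σ.tracked
    exact ⟨comp r s, fun a x h => by rw [comp_app]; exact hr _ _ (hs _ _ h)⟩

/-- Substitution in terms. -/
def Tm.sub {A : Ty Δ ℓ} (t : Tm A) (σ : Γ ⟶ Δ) : Tm (A.sub σ) where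
  val x := t.val (σ.toFun x)
  tracked := by
    obtain ⟨r, hr⟩ := t.tracked
    obtain ⟨s, hs⟩ := σ.tracked
    exact ⟨comp r s, fun a x h => by rw [comp_app]; exact hr _ _ (hs _ _ h)⟩

/-- The extended substitution `⟨σ, t⟩`. -/
def pairHom {A : Ty Δ ℓ} (σ : Γ ⟶ Δ) (t : Tm (A.sub σ)) : Γ ⟶ ext A where
  toFun x := ⟨σ.toFun x, t.val x, t.isClass x⟩
  tracked := by
    obtain ⟨s, hs⟩ := σ.tracked
    obtain ⟨r, hr⟩ := t.tracked
    refine ⟨S (comp pair s) r, fun a x h => ?_⟩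
    simp only [S_app, comp_app, ext, fst_pair, snd_pair]
    exact ⟨hs a x h, hr a x h⟩

/-- The substitution `⟨id, a⟩`. -/
def instHom {A : Ty Γ ℓ} (a : Tm A) : Γ ⟶ ext A := pairHom (𝟙 Γ) a

/-- The category with families of assemblies and types with codes. -/
def cwf : LeveledCwF.{1, 0} where
  Ctx := Asm
  emp := ⟨PUnit, fun _ _ => True, fun _ => ⟨K, trivial⟩⟩
  empTerminal := Limits.IsTerminal.ofUniqueHom
    (fun Γ => Hom.mk (fun _ => ⟨⟩) ⟨K, fun _ _ _ => trivial⟩)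
    fun Γ σ => rfl
  Ty := Ty
  Tm := Tm
  tySub := Ty.sub
  tySub_id A := rfl
  tySub_comp A σ τ := rfl
  tmSub := Tm.sub
  tmSub_id t := HEq.rfl
  tmSub_comp t σ τ := HEq.rfl
  ext := ext
  p A := ⟨ExtPt.base, fst, fun a x h => h.1⟩
  q A := ⟨ExtPt.val, snd, fun a x h => h.2⟩
  pair := pairHom
  pair_p σ t := rfl
  pair_q σ t := HEq.rfl
  pair_unique {Γ Δ ℓ A} τ τ' hp hq := by
    refine Hom.ext (funext fun x => ExtPt.ext (congrFun (congrArg Hom.toFun hp) x) ?_)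
    have e := congrArg Hom.toFun hp
    exact congrFun (Tm.val_eq_of_heq
      (A := ⟨fun x => A.rel (τ.toFun x).base, _⟩) (B := ⟨fun x => A.rel (τ'.toFun x).base, _⟩)
      (Ty.ext (funext fun x => congrArg A.rel (congrFun e x))) hq) x

/-! ### Dependent functions and dependent pairs -/

section Fibre

variable {A : Ty Γ m}

/-- The point of the extended context given by a realizer of an element of the fibre. -/
def ExtPt.ofRz (x : Γ.carrier) (a : Rz) (h : A.rel x a a) : ExtPt A := ⟨x, A.rel x a, a, h, rfl⟩

theorem ExtPt.ofRz_eq {x : Γ.carrier} {a b : Rz} (h : A.rel x a b) :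
    (ExtPt.ofRz x a ((A.isPer x).left h) : ExtPt A) = .ofRz x b ((A.isPer x).right h) :=
  ExtPt.ext rfl ((A.isPer x).class_eq h)

theorem real_ofRz {c x a} (hc : Γ.real c x) (h : A.rel x a a) :
    (ext A).real (pair c a) (.ofRz x a h) := by
  simp only [ext, fst_pair, snd_pair]
  exact ⟨hc, h, rfl⟩

/-- The fibres of `B` over the fibre of `A` at `x`, indexed by realizers. -/
def fibre (B : Ty (ext A) n) (x : Γ.carrier) : Rz → Rel := fun a u v =>
  ∃ h, B.rel (.ofRz x a h) u v

theorem fibre_eq (B : Ty (ext A) n) {x a} (h : A.rel x a a) :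
    fibre B x a = B.rel (.ofRz x a h) := by
  funext u v
  exact propext ⟨fun ⟨_, h⟩ => h, fun h' => ⟨h, h'⟩⟩

/-- Realizers of the same element give the same fibre. -/
theorem fibre_congr (B : Ty (ext A) n) {x a b} (h : A.rel x a b) :
    fibre B x a = fibre B x b := by
  rw [fibre_eq B ((A.isPer x).left h), fibre_eq B ((A.isPer x).right h), ExtPt.ofRz_eq h]

/-- Codes for the fibres of a type and of a dependent type over it, raised to a common level. -/
theorem exists_codes (A : Ty Γ m) (B : Ty (ext A) n) : ∃ r s : Rz, ∀ c x, Γ.real c x →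
    Dec (max m n) (r c) (A.rel x) ∧
      ∀ a, A.rel x a a → Dec (max m n) (s c a) (fibre B x a) := by
  obtain ⟨u, hu⟩ := exists_up (le_max_left m n)
  obtain ⟨v, hv⟩ := exists_up (le_max_right m n)
  obtain ⟨r, hr⟩ := A.tracked
  obtain ⟨s, hs⟩ := B.tracked
  refine ⟨comp u r, cur (comp v s), fun c x hc => ⟨?_, fun a ha => ?_⟩⟩
  · rw [comp_app]; exact hu _ _ (hr _ _ hc)
  · rw [cur_app, comp_app, fibre_eq B ha]; exact hv _ _ (hs _ _ (real_ofRz hc ha))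

/-- Dependent function types, as PERs of realizers. -/
def piTy (A : Ty Γ m) (B : Ty (ext A) n) : Ty Γ (max m n) where
  rel x := piRel (A.rel x) (fibre B x)
  tracked := by
    obtain ⟨r, s, h⟩ := exists_codes A B
    refine ⟨comp (mk (max m n) .pi) (S (comp pair r) s), fun c x hc => ?_⟩
    rw [comp_app, S_app, comp_app]
    exact .pi (h c x hc).1 (h c x hc).2 fun _ _ => fibre_congr B

/-- Dependent pair types, as PERs of realizers. -/
def sigmaTy (A : Ty Γ m) (B : Ty (ext A) n) : Ty Γ (max m n) where
  rel x := sigmaRel (A.rel x) (fibre B x)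
  tracked := by
    obtain ⟨r, s, h⟩ := exists_codes A B
    refine ⟨comp (mk (max m n) .sigma) (S (comp pair r) s), fun c x hc => ?_⟩
    rw [comp_app, S_app, comp_app]
    exact .sigma (h c x hc).1 (h c x hc).2 fun _ _ => fibre_congr B

/-- Abstraction. The realizers of `lam b` at `x` are those that send realizers `a` to realizers
of the value of `b` at `(x, a)`. -/
def lam {B : Ty (ext A) n} (b : Tm B) : Tm (piTy A B) where
  val x g := ∀ a h, b.val (.ofRz x a h) (g a)
  tracked := by
    refine ⟨cur b.rz, fun c x hc => ?_⟩
    have key : ∀ g : Rz, (∀ a h, b.val (.ofRz x a h) (g a)) ↔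
        (piTy A B).rel x (cur b.rz c) g := by
      refine fun g => ⟨fun h a a' haa' => ?_, fun h a ha => ?_⟩
      · have ha := (A.isPer x).left haa'
        rw [fibre_eq B ha, cur_app, ← b.val_eq_rz (real_ofRz hc ha), ExtPt.ofRz_eq haa']
        exact h _ _
      · have := h a a ha
        rwa [fibre_eq B ha, cur_app, ← b.val_eq_rz (real_ofRz hc ha)] at this
    refine ⟨(key _).1 fun a ha => ?_, funext fun g => propext (key g)⟩
    rw [cur_app]
    exact b.rz_mem (real_ofRz hc ha)

theorem lam_bijective {B : Ty (ext A) n} : Function.Bijective (lam (B := B)) := by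
  constructor
  · intro b b' hbb'
    refine Tm.ext_of_common fun ⟨x, _, a, ha, e⟩ => ?_
    subst e
    obtain ⟨c, hc⟩ := Γ.exists_real x
    have h : (lam b).val x (cur b.rz c) := fun a ha => by
      rw [cur_app]; exact b.rz_mem (real_ofRz hc ha)
    refine ⟨cur b.rz c a, h a ha, ?_⟩
    rw [hbb'] at h
    exact h a ha
  · intro f
    have h : ∀ c c' (w : ExtPt A), (ext A).real c w → (ext A).real c' w →
        B.rel w (S (comp f.rz fst) snd c) (S (comp f.rz fst) snd c') := by
      rintro c c' w ⟨h₁, h₂, h₃⟩ ⟨h₁', h₂', h₃'⟩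
      have e : w = .ofRz w.base (snd c) h₂ := ExtPt.ext rfl h₃
      have := f.rel_of_val (f.rz_mem h₁) (f.rz_mem h₁') (snd c) (snd c')
        (by rw [← h₃, h₃']; exact h₂')
      rw [fibre_eq B h₂, ← e] at this
      simpa using this
    refine ⟨Tm.ofRz B (S (comp f.rz fst) snd) h, Tm.ext_of_common fun x => ?_⟩
    obtain ⟨c, hc⟩ := Γ.exists_real x
    refine ⟨f.rz c, fun a ha => ?_, f.rz_mem hc⟩
    have := Tm.ofRz_mem B _ h (real_ofRz hc ha)
    simpa using this

/-- Abstraction as a bijection. -/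
noncomputable def lamEquiv {B : Ty (ext A) n} : Tm B ≃ Tm (piTy A B) :=
  Equiv.ofBijective lam lam_bijective

noncomputable def piTypes : PiTypes cwf where
  Pi := piTy
  Pi_sub _ _ _ := rfl
  lam := lamEquiv
  lam_sub _ _ _ _ := HEq.rfl

/-- Pairing. The realizers are those whose two components realize the two given terms. -/
def dpair {B : Ty (ext A) n} (a : Tm A) (b : Tm (B.sub (instHom a))) :
    Tm (sigmaTy A B) where
  val x p := a.val x (fst p) ∧ b.val x (snd p)
  tracked := by
    refine ⟨S (comp pair a.rz) b.rz, fun c x hc => ?_⟩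
    have key : ∀ p : Rz, (a.val x (fst p) ∧ b.val x (snd p)) ↔
        (sigmaTy A B).rel x (S (comp pair a.rz) b.rz c) p := by
      intro p
      have e : fibre B x (a.rz c) = B.rel ⟨x, a.val x, a.isClass x⟩ := by
        rw [fibre_eq B (a.rz_rel hc)]
        exact congrArg B.rel (ExtPt.ext rfl (a.val_eq_rz hc).symm)
      simp only [sigmaTy, sigmaRel, S_app, comp_app, fst_pair, snd_pair]
      rw [e]
      exact and_congr (iff_of_eq (congrFun (a.val_eq_rz hc) _))
        (iff_of_eq (congrFun (b.val_eq_rz hc) _))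
    refine ⟨(key _).1 ?_, funext fun p => propext (key p)⟩
    simp only [S_app, comp_app, fst_pair, snd_pair]
    exact ⟨a.rz_mem hc, b.rz_mem hc⟩

theorem dpair_bijective {B : Ty (ext A) n} : Function.Bijective
    fun s : (a : Tm A) × Tm (B.sub (instHom a)) => dpair s.1 s.2 := by
  constructor
  · rintro ⟨a, b⟩ ⟨a', b'⟩ h
    have key : ∀ x, ∃ u v, (a.val x u ∧ b.val x v) ∧ (a'.val x u ∧ b'.val x v) := by
      intro x
      obtain ⟨p, hp⟩ := (dpair a b).exists_val x
      exact ⟨fst p, snd p, hp, (congrFun (congrFun (congrArg Tm.val h) x) p).mp hp⟩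
    obtain rfl : a = a' := Tm.ext_of_common fun x =>
      let ⟨u, _, h, h'⟩ := key x; ⟨u, h.1, h'.1⟩
    obtain rfl : b = b' := Tm.ext_of_common fun x =>
      let ⟨_, v, h, h'⟩ := key x; ⟨v, h.2, h'.2⟩
    rfl
  · intro s
    have h₁ : ∀ c c' x, Γ.real c x → Γ.real c' x →
        A.rel x (comp fst s.rz c) (comp fst s.rz c') := by
      intro c c' x hc hc'
      simp only [comp_app]
      exact (s.rel_of_val (s.rz_mem hc) (s.rz_mem hc')).1
    let a : Tm A := Tm.ofRz A _ h₁
    have h₂ : ∀ c c' x, Γ.real c x → Γ.real c' x →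
        (B.sub (instHom a)).rel x (comp snd s.rz c) (comp snd s.rz c') := by
      intro c c' x hc hc'
      have hs := s.rel_of_val (s.rz_mem hc) (s.rz_mem hc')
      have ha : a.val x (fst (s.rz c)) := by
        have := Tm.ofRz_mem A _ h₁ hc
        rwa [comp_app] at this
      have := hs.2
      rw [fibre_eq B (a.rel_of_val ha ha)] at this
      have e : (instHom a).toFun x = .ofRz x (fst (s.rz c)) (a.rel_of_val ha ha) :=
        ExtPt.ext rfl (a.val_eq ha)
      rw [comp_app, comp_app]
      exact (congrArg B.rel e) ▸ this
    refine ⟨⟨a, Tm.ofRz _ _ h₂⟩, Tm.ext_of_common fun x => ?_⟩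
    obtain ⟨c, hc⟩ := Γ.exists_real x
    have h₁ := Tm.ofRz_mem A _ h₁ hc
    have h₂ := Tm.ofRz_mem _ _ h₂ hc
    rw [comp_app] at h₁ h₂
    exact ⟨s.rz c, ⟨h₁, h₂⟩, s.rz_mem hc⟩

/-- Pairing as a bijection. -/
noncomputable def dpairEquiv {B : Ty (ext A) n} :
    ((a : Tm A) × Tm (B.sub (instHom a))) ≃ Tm (sigmaTy A B) :=
  Equiv.ofBijective _ dpair_bijective

noncomputable def sigmaTypes : SigmaTypes cwf where
  Sig := sigmaTy
  Sig_sub _ _ _ := rfl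
  dpair := dpairEquiv
  dpair_sub _ _ _ _ _ := HEq.rfl

end Fibre

/-! ### Unit, empty type, booleans and natural numbers -/

/-- The constant family given by a type constructor without arguments. It exists at all levels. -/
def baseTy (b : BaseTag) (Γ : Asm) (ℓ : ℕ) : Ty Γ ℓ where
  rel _ := baseRel (Below ℓ) b
  tracked := ⟨K (code ℓ (.base b) K), fun a x _ => by rw [K_app]; exact dec_base ℓ b⟩

/-- The constant term with a given realizer. -/
def constTm (b : BaseTag) (Γ : Asm) (ℓ : ℕ) (u : Rz) (h : baseRel (Below ℓ) b u u) :
    Tm (baseTy b Γ ℓ) where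
  val _ := baseRel (Below ℓ) b u
  tracked := ⟨K u, fun a x _ => by rw [K_app]; exact ⟨h, rfl⟩⟩

def unitType : UnitType cwf where
  unitTy Γ := baseTy .unit Γ 0
  unitTy_sub _ := rfl
  star Γ := constTm .unit Γ 0 K trivial
  star_unique t := Tm.ext_of_common fun x => let ⟨u, hu⟩ := Tm.exists_val t x; ⟨u, hu, trivial⟩

def emptyType : EmptyType cwf where
  emptyTy Γ := baseTy .empty Γ 0
  emptyTy_sub _ := rfl
  emptyElim _ := ⟨fun _ _ => False, K, fun _ w _ => w.isClass.elim fun _ h => h.1.elim⟩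
  emptyElim_sub _ _ := rfl

/-- The eliminator of the booleans, whose value is selected by the class of `tt` or `ff`. -/
def boolElim (C : Ty (ext (baseTy .bool Γ 0)) n)
    (t : Tm (C.sub (instHom (constTm .bool Γ 0 tt (.inl ⟨rfl, rfl⟩)))))
    (f : Tm (C.sub (instHom (constTm .bool Γ 0 ff (.inr ⟨rfl, rfl⟩))))) : Tm C where
  val w u := (w.val tt ∧ t.val w.base u) ∨ (w.val ff ∧ f.val w.base u)
  tracked := by
    refine ⟨S (S snd (comp t.rz fst)) (comp f.rz fst), ?_⟩
    rintro c ⟨x, _, a, ha, rfl⟩ ⟨h₁, h₂, h₃⟩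
    have h₁ : Γ.real (fst c) x := h₁
    have hc : snd c = a := by
      have := congrFun h₃ (snd c) ▸ h₂
      rcases this with ⟨h, h'⟩ | ⟨h, h'⟩ <;> rw [h, h']
    obtain ⟨rfl, -⟩ | ⟨rfl, -⟩ := ha
    · have e : ∀ u, ((boolRel tt tt ∧ t.val x u) ∨ (boolRel tt ff ∧ f.val x u)) ↔
          t.val x u := by simp [boolRel, tt_ne_ff, tt_ne_ff.symm]
      simp only [S_app, comp_app, hc, tt_app]
      exact ⟨t.rz_rel h₁, (funext fun u => propext (e u)).trans (t.val_eq_rz h₁)⟩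
    · have e : ∀ u, ((boolRel ff tt ∧ t.val x u) ∨ (boolRel ff ff ∧ f.val x u)) ↔
          f.val x u := by simp [boolRel, tt_ne_ff, tt_ne_ff.symm]
      simp only [S_app, comp_app, hc, ff_app]
      exact ⟨f.rz_rel h₁, (funext fun u => propext (e u)).trans (f.val_eq_rz h₁)⟩

def boolType : BoolType cwf where
  boolTy Γ := baseTy .bool Γ 0
  boolTy_sub _ := rfl
  tt Γ := constTm .bool Γ 0 tt (.inl ⟨rfl, rfl⟩)
  ff Γ := constTm .bool Γ 0 ff (.inr ⟨rfl, rfl⟩)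
  tt_sub _ := HEq.rfl
  ff_sub _ := HEq.rfl
  boolElim := boolElim
  boolElim_tt _ t _ := Tm.ext_of_common fun x =>
    let ⟨u, hu⟩ := Tm.exists_val t x; ⟨u, .inl ⟨.inl ⟨rfl, rfl⟩, hu⟩, hu⟩
  boolElim_ff _ _ f := Tm.ext_of_common fun x =>
    let ⟨u, hu⟩ := Tm.exists_val f x; ⟨u, .inr ⟨.inr ⟨rfl, rfl⟩, hu⟩, hu⟩
  boolElim_sub _ _ _ _ := rfl

/-- The successor of a term. -/
def succTm (t : Tm (baseTy .nat Γ 0)) : Tm (baseTy .nat Γ 0) where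
  val x u := ∃ k, t.val x (num k) ∧ u = num (k + 1)
  tracked := by
    refine ⟨comp succ t.rz, fun a x h => ?_⟩
    obtain ⟨k, hk, -⟩ := t.rz_rel h
    have : succ (num k) = num (k + 1) := rfl
    rw [comp_app, t.val_eq_rz h, hk, this]
    refine ⟨⟨_, rfl, rfl⟩, funext fun u => propext ⟨?_, ?_⟩⟩
    · rintro ⟨k', ⟨l, hl, hl'⟩, rfl⟩
      exact ⟨k + 1, rfl, by rw [num_inj hl, num_inj hl']⟩
    · rintro ⟨l, hl, rfl⟩
      exact ⟨k, ⟨k, rfl, rfl⟩, by rw [hl]⟩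

def natIntro : NatIntro cwf where
  natTy Γ := baseTy .nat Γ 0
  natTy_sub _ := rfl
  zero Γ := constTm .nat Γ 0 (num 0) ⟨0, rfl, rfl⟩
  zero_sub _ := HEq.rfl
  succ := succTm
  succ_sub _ _ := rfl

/-- The numeral `k` as a point of the context `Γ, ℕ`. -/
def numPt (x : Γ.carrier) (k : ℕ) : ExtPt (baseTy .nat Γ 0) := .ofRz x (num k) ⟨k, rfl, rfl⟩

theorem succSub_numPt (x : Γ.carrier) (k : ℕ) :
    (natIntro.succSub Γ).toFun (numPt x k) = numPt x (k + 1) :=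
  ExtPt.ext rfl <| funext fun u => propext <| show (∃ l, natRel (num k) (num l) ∧ u = num (l + 1)) ↔
      natRel (num (k + 1)) u by
    constructor
    · rintro ⟨l, h, rfl⟩
      rw [num_class.1 h]
      exact ⟨_, rfl, rfl⟩
    · rintro ⟨l, h, rfl⟩
      exact ⟨k, ⟨k, rfl, rfl⟩, by rw [h]⟩

section NatElim

variable (C : Ty (ext (baseTy .nat Γ 0)) n)
  (z : Tm (C.sub (instHom (constTm .nat Γ 0 (num 0) ⟨0, rfl, rfl⟩))))
  (s : Tm (C.sub ((cwf.p C : ext C ⟶ _) ≫ natIntro.succSub Γ)))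

/-- The value at the numeral `k` of the function defined by primitive recursion from `z` and
`s`. The side condition, that the previous value is an element of its fibre, always holds
(`natVal_isClass`). -/
def natVal (x : Γ.carrier) : ℕ → Rz → Prop
  | 0 => z.val x
  | k + 1 => fun u => ∃ h, s.val ⟨numPt x k, natVal x k, h⟩ u

/-- The numeral itself computes the values, being a recursor. -/
theorem natVal_spec {c : Rz} {x : Γ.carrier} (hc : Γ.real c x) (k : ℕ) :
    C.rel (numPt x k) (num k (z.rz c) (cur (cur s.rz) c)) (num k (z.rz c) (cur (cur s.rz) c)) ∧
      natVal C z s x k = C.rel (numPt x k) (num k (z.rz c) (cur (cur s.rz) c)) := by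
  induction k with
  | zero =>
    rw [num_zero_app]
    exact ⟨z.rz_rel hc, z.val_eq_rz hc⟩
  | succ k ih =>
    rw [num_succ_app, cur_app, cur_app]
    have hr : (ext C).real (pair (pair c (num k)) (num k (z.rz c) (cur (cur s.rz) c)))
        ⟨numPt x k, natVal C z s x k, _, ih⟩ := by
      refine ⟨?_, ?_⟩
      · rw [fst_pair]; exact real_ofRz (A := baseTy .nat Γ 0) hc ⟨k, rfl, rfl⟩
      · rw [snd_pair]; exact ih
    rw [← succSub_numPt]
    exact ⟨s.rz_rel hr, (funext fun u => propext ⟨fun ⟨_, h⟩ => h, fun h => ⟨_, h⟩⟩).trans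
      (s.val_eq_rz hr)⟩

theorem natVal_isClass (x : Γ.carrier) (k : ℕ) :
    ∃ a, C.rel (numPt x k) a a ∧ natVal C z s x k = C.rel (numPt x k) a :=
  let ⟨_, hc⟩ := Γ.exists_real x
  ⟨_, natVal_spec C z s hc k⟩

/-- The eliminator of the natural numbers. -/
def natElim : Tm C where
  val w u := ∃ k, w.val (num k) ∧ natVal C z s w.base k u
  tracked := by
    refine ⟨S (S snd (comp z.rz fst)) (comp (cur (cur s.rz)) fst), ?_⟩
    rintro c w ⟨h₁, h₂, h₃⟩
    obtain ⟨k, hk, -⟩ := h₂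
    have hw : w = numPt w.base k := ExtPt.ext rfl (by rw [h₃, hk]; rfl)
    have e : ∀ u, (∃ l, w.val (num l) ∧ natVal C z s w.base l u) ↔ natVal C z s w.base k u := by
      refine fun u => ⟨fun ⟨l, hl, hu⟩ => ?_, fun hu => ⟨k, ?_, hu⟩⟩
      · rw [h₃, hk] at hl
        rwa [num_class.1 hl]
      · rw [h₃, hk]
        exact ⟨k, rfl, rfl⟩
    simp only [S_app, comp_app, hk]
    obtain ⟨h, h'⟩ := natVal_spec C z s h₁ k
    rw [← hw] at h h'
    exact ⟨h, (funext fun u => propext (e u)).trans h'⟩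

theorem natElim_val (x : Γ.carrier) (k : ℕ) :
    (natElim C z s).val (numPt x k) = natVal C z s x k :=
  funext fun u => propext <| show (∃ l, natRel (num k) (num l) ∧ natVal C z s x l u) ↔ _ from
    ⟨fun ⟨_, h, h'⟩ => num_class.1 h ▸ h', fun h => ⟨k, ⟨k, rfl, rfl⟩, h⟩⟩

end NatElim

theorem exists_eq_numPt (w : ExtPt (baseTy .nat Γ 0)) : ∃ x k, w = numPt x k := by
  obtain ⟨x, _, a, ⟨k, rfl, -⟩, rfl⟩ := w
  exact ⟨x, k, rfl⟩

theorem natVal_sub (σ : Γ ⟶ Δ) {C : Ty (ext (baseTy .nat Δ 0)) n}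
    {z : Tm (C.sub (instHom (constTm .nat Δ 0 (num 0) ⟨0, rfl, rfl⟩)))}
    {s : Tm (C.sub ((cwf.p C : ext C ⟶ _) ≫ natIntro.succSub Δ))}
    {C' : Ty (ext (baseTy .nat Γ 0)) n}
    {z' : Tm (C'.sub (instHom (constTm .nat Γ 0 (num 0) ⟨0, rfl, rfl⟩)))}
    {s' : Tm (C'.sub ((cwf.p C' : ext C' ⟶ _) ≫ natIntro.succSub Γ))}
    (hC : ∀ x k, C'.rel (numPt x k) = C.rel (numPt (σ.toFun x) k))
    (hz : ∀ x, z'.val x = z.val (σ.toFun x))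
    (hs : ∀ x k e h h', s'.val ⟨numPt x k, e, h⟩ = s.val ⟨numPt (σ.toFun x) k, e, h'⟩)
    (x : Γ.carrier) (k : ℕ) : natVal C z s (σ.toFun x) k = natVal C' z' s' x k := by
  induction k with
  | zero => exact (hz x).symm
  | succ k ih =>
    have h := natVal_isClass C z s (σ.toFun x) k
    have h' := natVal_isClass C' z' s' x k
    funext u
    simp only [natVal, h, h', exists_true_left]
    rw [hs x k _ h' (by rw [← hC]; exact h')]
    congr 2

def natType : NatType cwf where
  toNatIntro := natIntro
  natElim := natElim
  natElim_zero C z s := Tm.ext (funext fun x => natElim_val C z s x 0)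
  natElim_succ {Γ n} C z s := heq_of_eq (Tm.ext (A := Ty.sub C (natIntro.succSub Γ)) (by
    funext w
    obtain ⟨x, k, rfl⟩ := exists_eq_numPt w
    refine (congrArg (natElim C z s).val (succSub_numPt x k)).trans ?_
    refine (natElim_val C z s x (k + 1)).trans ?_
    refine (funext fun u => propext ⟨fun ⟨_, h⟩ => h, fun h => ⟨natVal_isClass C z s x k, h⟩⟩ :
      natVal C z s x (k + 1) =
        s.val ⟨numPt x k, natVal C z s x k, natVal_isClass C z s x k⟩).trans ?_
    exact congrArg s.val (ExtPt.ext rfl (natElim_val C z s x k).symm)))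
  natElim_sub σ C z s := by
    refine Tm.ext (funext fun w => funext fun u => propext
      (exists_congr fun k => and_congr_right fun _ => ?_))
    refine iff_of_eq (congrFun (natVal_sub σ ?_ ?_ ?_ w.base k) u)
    · exact fun _ _ => rfl
    · exact fun _ => rfl
    · exact fun _ _ _ _ _ => rfl

/-! ### Identity types -/

/-- The identity type of `a` and `b`: all realizers are related if `a` and `b` are equal, and none
otherwise. -/
def identTy {A : Ty Γ ℓ} (a b : Tm A) : Ty Γ ℓ where
  rel x _ _ := a.val x = b.val x
  tracked := by
    obtain ⟨r, hr⟩ := A.tracked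
    refine ⟨comp (mk ℓ .ident) (S (comp pair r) (S (comp pair a.rz) b.rz)), fun c x hc => ?_⟩
    have e : (fun _ _ : Rz => a.val x = b.val x) = fun _ _ => A.rel x (a.rz c) (b.rz c) := by
      funext _ _
      refine propext ⟨fun h => a.rel_of_val (a.rz_mem hc) (h ▸ b.rz_mem hc), fun h => ?_⟩
      rw [a.val_eq_rz hc, b.val_eq_rz hc, (A.isPer x).class_eq h]
    simp only [e, comp_app, S_app]
    exact (hr c x hc).ident _ _

def identIntro : IdIntro cwf where
  Id := identTy
  Id_sub _ _ _ _ := rfl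
  refl _ := ⟨fun _ _ => True, K, fun _ _ _ => ⟨rfl, funext fun _ =>
    propext ⟨fun _ => rfl, fun _ => trivial⟩⟩⟩
  refl_sub _ _ _ := HEq.rfl

def identTypes : IdTypes cwf where
  toIdIntro := identIntro
  J {_ _ _ _} a C d := {
    val := fun w => Tm.val d w.base.base
    tracked := by
      obtain ⟨r, hr⟩ := Tm.tracked d
      refine ⟨comp r (comp fst fst), fun c w hc => ?_⟩
      -- The last two variables are determined by the base point, so `d` itself is the answer.
      have e : w = (identIntro.reflSub a).toFun w.base.base := by
        obtain ⟨u, hu, hw⟩ := w.isClass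
        have hu : Tm.val a w.base.base = w.base.val := hu
        refine ExtPt.ext (ExtPt.ext rfl hu.symm) (hw.trans ?_)
        exact funext fun v => propext ⟨fun _ => trivial, fun _ => hu⟩
      rw [comp_app, comp_app]
      obtain ⟨h₁, h₂⟩ := hr _ _ hc.1.1
      exact ⟨(congrFun (congrFun (congrArg (Ty.rel C) e) _) _).mpr h₁,
        h₂.trans (congrFun (congrArg (Ty.rel C) e) _).symm⟩ }
  J_refl _ _ _ := rfl
  J_sub _ _ _ _ _ := rfl

/-! ### Universes and cumulativity -/

/-- The universe of types of level `ℓ`. -/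
def univTy (Γ : Asm) (ℓ : ℕ) : Ty Γ (ℓ + 1) := baseTy .univ Γ (ℓ + 1)

/-- The term of the universe that names a type. -/
def quoteTy (A : Ty Γ ℓ) : Tm (univTy Γ ℓ) where
  val x d := Dec ℓ d (A.rel x)
  tracked := by
    obtain ⟨r, hr⟩ := A.tracked
    refine ⟨r, fun a x h => ⟨⟨_, hr a x h, hr a x h⟩, funext fun d => propext ?_⟩⟩
    exact ⟨fun hd => ⟨_, hr a x h, hd⟩, fun ⟨R, h₁, h₂⟩ => (hr a x h).eq h₁ ▸ h₂⟩

/-- A term of the universe determines the PER denoted by its codes, as codes are single-valued. -/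
theorem quoteTy_bijective : Function.Bijective (quoteTy : Ty Γ ℓ → _) := by
  constructor
  · intro A B h
    refine Ty.ext (funext fun x => ?_)
    obtain ⟨d, hd⟩ := (quoteTy A).exists_val x
    exact Dec.eq hd ((congrFun (congrFun (congrArg Tm.val h) x) d).mp hd)
  · intro X
    have h : ∀ x, ∃ R, ∀ d, X.val x d → Dec ℓ d R := by
      intro x
      obtain ⟨d, hd⟩ := X.exists_val x
      obtain ⟨R, hR, -⟩ := X.rel_of_val hd hd
      refine ⟨R, fun d' hd' => ?_⟩
      obtain ⟨R', h₁, h₂⟩ := X.rel_of_val hd hd'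
      exact Dec.eq (ℓ := ℓ) hR h₁ ▸ h₂
    choose R hR using h
    refine ⟨⟨R, X.rz, fun a x ha => hR x _ (X.rz_mem ha)⟩, Tm.ext_of_common fun x => ?_⟩
    obtain ⟨d, hd⟩ := X.exists_val x
    exact ⟨d, hR x d hd, hd⟩

/-- The type named by a term of the universe. -/
noncomputable def el : Tm (univTy Γ ℓ) ≃ Ty Γ ℓ :=
  (Equiv.ofBijective quoteTy quoteTy_bijective).symm

theorem el_eq_iff {X : Tm (univTy Γ ℓ)} {A : Ty Γ ℓ} : el X = A ↔ X = quoteTy A :=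
  Equiv.symm_apply_eq _

theorem quoteTy_el (X : Tm (univTy Γ ℓ)) : quoteTy (el X) = X := (el_eq_iff.1 rfl).symm

theorem el_quoteTy (A : Ty Γ ℓ) : el (quoteTy A) = A := el_eq_iff.2 rfl

theorem el_sub (σ : Γ ⟶ Δ) (X : Tm (univTy Δ ℓ)) :
    (el X).sub σ = el (X.sub σ : Tm (univTy Γ ℓ)) := by
  refine (el_eq_iff.2 ?_).symm
  exact Tm.ext (funext fun x => congrFun (congrArg Tm.val (quoteTy_el X).symm) (σ.toFun x))

noncomputable def universes : Universes cwf where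
  U := univTy
  U_sub _ _ := rfl
  El := el
  El_sub := el_sub

/-- A type seen as a type of the next level, with the same elements. -/
def liftTy (A : Ty Γ ℓ) : Ty Γ (ℓ + 1) where
  rel := A.rel
  tracked := by
    obtain ⟨r, hr⟩ := A.tracked
    exact ⟨comp (mk (ℓ + 1) .up) r, fun a x h => by rw [comp_app]; exact (hr a x h).up⟩

/-- The lifting of terms of the universe. -/
noncomputable def liftTm (X : Tm (univTy Γ ℓ)) : Tm (univTy Γ (ℓ + 1)) := quoteTy (liftTy (el X))

theorem rel_liftTm (X : Tm (univTy Γ ℓ)) : (el (liftTm X)).rel = (el X).rel := by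
  rw [liftTm, el_quoteTy]; rfl

/-- Types with the same PERs have the same terms, even if their levels are different. -/
def Tm.relabel {A : Ty Γ m} {B : Ty Γ n} (h : A.rel = B.rel) : Tm A ≃ Tm B where
  toFun t := ⟨t.val, h ▸ t.tracked⟩
  invFun t := ⟨t.val, h ▸ t.tracked⟩
  left_inv _ := rfl
  right_inv _ := rfl

theorem val_conv {A B : Ty Γ ℓ} (h : A = B) (t : Tm A) :
    Tm.val (conv (M := cwf) h t : Tm B) = t.val := by
  subst h; rfl

noncomputable def agdaLift : AgdaLift cwf universes where
  Lift := liftTm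
  Lift_sub σ X :=
    congrArg quoteTy (congrArg liftTy (el_sub σ X) :
      (liftTy (el X)).sub σ = liftTy (el (Tm.sub X σ)))
  iso X := Tm.relabel (rel_liftTm X)
  iso_sub σ X t := Tm.ext <| (val_conv (universes.El_sub σ X) _).trans
    (val_conv ((el_sub σ (liftTm X)).trans
      (congrArg (fun A => el (quoteTy (liftTy A))) (el_sub σ X))) (Tm.sub t σ)).symm

/-! ### The model -/

/-- The realizability model. -/
noncomputable def model : Model.{1, 0} where
  toLeveledCwF := cwf
  pi := piTypes
  sigma := sigmaTypes
  unit := unitType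
  empty := emptyType
  bool := boolType
  nat := natType
  ident := identTypes
  univ := universes
  cumul := agdaLift

theorem model_nontrivial : model.Nontrivial := by
  constructor
  · exact ⟨fun t => (Tm.isClass t ⟨⟩).elim fun _ h => h.1⟩
  · intro h
    have h : boolRel tt tt = boolRel ff tt := congrFun (congrFun (congrArg Tm.val h) ⟨⟩) tt
    simp [boolRel, tt_ne_ff, tt_ne_ff.symm] at h

/-- A term of a type of level `ℓ` that depends on a variable of the universe `U ℓ` does not change
with this variable. -/
theorem Tm.val_eq_of_univ {A : Ty Γ ℓ} (g : Tm (A.sub (cwf.p (univTy Γ ℓ)) : Ty (ext _) ℓ))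
    {w w' : ExtPt (univTy Γ ℓ)} (h : w.base = w'.base) : g.val w = g.val w' := by
  obtain ⟨x, e, d, hd, rfl⟩ := w
  obtain ⟨y, e', d', hd', rfl⟩ := w'
  obtain rfl : x = y := h
  obtain ⟨c, hc⟩ := Γ.exists_real x
  have h₁ := g.val_eq_rz (real_ofRz (A := univTy Γ ℓ) hc hd)
  have h₂ := g.val_eq_rz (real_ofRz (A := univTy Γ ℓ) hc hd')
  refine h₁.trans (Eq.trans (funext fun u => propext ?_) h₂.symm)
  refine (A.isPer x).congr ?_ rfl
  obtain ⟨R, hR, -⟩ := hd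
  obtain ⟨R', hR', -⟩ := hd'
  -- Both codes are erased, so the values at them have realizers with the same erasure.
  have e : erase ℓ d = star := Decodes.erase_eq_star hR
  have e' : erase ℓ d' = star := Decodes.erase_eq_star hR'
  simp only [erase_app, erase_pair, e, e']

theorem model_isConstant (Γ : model.Ctx) (ℓ : ℕ) (A : model.Tm (model.univ.U Γ ℓ))
    (f : model.Tm (Model.arrow (model.univ.U Γ ℓ) (model.univ.El A))) :
    Model.IsConstant f := by
  obtain ⟨g, rfl⟩ := model.pi.lam.surjective f
  -- Any type can serve as the argument at which the constant value is taken.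
  let X : Γ ⟶ ext (univTy Γ ℓ) := instHom (quoteTy (baseTy .unit Γ ℓ))
  refine ⟨Tm.sub g X, congrArg model.pi.lam (Tm.ext (funext fun w => ?_))⟩
  exact Tm.val_eq_of_univ (A := el A) g rfl

end ErasureModel

theorem mainTheorem1 :
    ∃ 𝓜 : DTT.Model.{1, 0}, 𝓜.Nontrivial ∧
      ∀ (Γ : 𝓜.Ctx) (ℓ : ℕ) (A : 𝓜.Tm (𝓜.univ.U Γ ℓ))
        (f : 𝓜.Tm (DTT.Model.arrow (𝓜.univ.U Γ ℓ) (𝓜.univ.El A))),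
        DTT.Model.IsConstant f := by
  exact ⟨ErasureModel.model, ErasureModel.model_nontrivial, ErasureModel.model_isConstant⟩
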